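/- Let $M$ be a connected noncompact $C^\infty$ manifold (Hausdorff, second countable, without boundary) of dimension $n$. Let $A$ be a second order locally uniformly elliptic linear differential operator on $M$ with locally bounded real coefficients; that is, in every system of smooth local coordinates $(x_1,\dots,x_n)$, $$A=\sum_{i,j=1}^n a_{ij}\frac{\partial^2}{\partial x_i\partial x_j}+\sum_{i=1}^n b_i\frac{\partial}{\partial x_i}+c,$$ where $a_{ij}$, $b_i$ and $c$ are locally bounded real-valued functions (not assumed continuous) and $(a_{ij})$ is a symmetric matrix-valued function whose eigenvalues are locally bounded below by a positive constant. Then for every positive continuous function $\rho$ on $M$ there exists a $C^\infty$ Morse function $\psi:M\to\mathbb R$ (a $C^\infty$ function all of whose critical points are nondegenerate) such that $\psi>\rho$ and $A\psi>\rho$ everywhere on $M$. -/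

import Mathlib

open scoped Manifold ContDiff

noncomputable section

namespace EllipticOp

/-- The `i`-th partial derivative `∂f/∂xᵢ` of a function on `ℝⁿ`. -/
def partialDeriv {n : ℕ} (i : Fin n) (f : EuclideanSpace ℝ (Fin n) → ℝ) :
    EuclideanSpace ℝ (Fin n) → ℝ :=
  fun y => fderiv ℝ f y (EuclideanSpace.single i 1)

/-- The Hessian matrix `(∂²f/∂xᵢ∂xⱼ)` of a function on `ℝⁿ`. -/
def hessian {n : ℕ} (f : EuclideanSpace ℝ (Fin n) → ℝ) (y : EuclideanSpace ℝ (Fin n)) :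
    Matrix (Fin n) (Fin n) ℝ :=
  Matrix.of fun i j => partialDeriv i (partialDeriv j f) y

/-- `f` is locally bounded at every point of the set `s` (used for open sets `s`). -/
def LocallyBoundedOn {M : Type*} [TopologicalSpace M] (f : M → ℝ) (s : Set M) : Prop :=
  ∀ x ∈ s, ∃ C : ℝ, ∀ᶠ y in nhds x, |f y| ≤ C

/-- The eigenvalues of the matrices `a y` are locally bounded below by a positive constant at
every point of the set `s` (used for open sets `s`). -/
def EigenvaluesLocallyBoundedBelowOn {M : Type*} [TopologicalSpace M] {n : ℕ}
    (a : M → Matrix (Fin n) (Fin n) ℝ) (s : Set M) : Prop :=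
  ∀ x ∈ s, ∃ δ : ℝ, 0 < δ ∧ ∀ᶠ y in nhds x,
    ∀ μ : ℝ, Module.End.HasEigenvalue (Matrix.toLin' (a y)) μ → δ ≤ μ

/-- `A` is, on functions of class `C²`, a second order locally uniformly elliptic linear
differential operator with locally bounded coefficients: in every smooth local coordinate system
`e = (x₁, …, xₙ)` of `M`,
`A = ∑ i j, aᵢⱼ ∂²/∂xᵢ∂xⱼ + ∑ i, bᵢ ∂/∂xᵢ + c`,
where `aᵢⱼ`, `bᵢ`, `c` are locally bounded real-valued functions on the coordinate domain (no
continuity is required) and `(aᵢⱼ)` is symmetric with eigenvalues locally bounded below by a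
positive constant. Values of `A` on functions which are not of class `C²` play no role. -/
def IsLocallyUniformlyElliptic (n : ℕ) {M : Type*} [TopologicalSpace M]
    [ChartedSpace (EuclideanSpace ℝ (Fin n)) M] (A : (M → ℝ) → (M → ℝ)) : Prop :=
  ∀ e ∈ IsManifold.maximalAtlas (𝓡 n) ∞ M,
    ∃ (a : M → Matrix (Fin n) (Fin n) ℝ) (b : M → Fin n → ℝ) (c : M → ℝ),
      (∀ i j, LocallyBoundedOn (fun x => a x i j) e.source) ∧
      (∀ i, LocallyBoundedOn (fun x => b x i) e.source) ∧
      LocallyBoundedOn c e.source ∧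
      (∀ x ∈ e.source, (a x).IsSymm) ∧
      EigenvaluesLocallyBoundedBelowOn a e.source ∧
      ∀ u : M → ℝ, ContMDiff (𝓡 n) 𝓘(ℝ, ℝ) 2 u → ∀ x ∈ e.source,
        A u x = ∑ i, ∑ j, a x i j * hessian (u ∘ e.symm) (e x) i j
          + ∑ i, b x i * partialDeriv i (u ∘ e.symm) (e x)
          + c x * u x

/-- `u` is a `C^∞` Morse function: it is smooth and each of its critical points is
nondegenerate, that is, the Hessian matrix in local coordinates is invertible there. -/
def IsMorse (n : ℕ) {M : Type*} [TopologicalSpace M]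
    [ChartedSpace (EuclideanSpace ℝ (Fin n)) M] (u : M → ℝ) : Prop :=
  ContMDiff (𝓡 n) 𝓘(ℝ, ℝ) ∞ u ∧
    ∀ x : M, mfderiv (𝓡 n) 𝓘(ℝ, ℝ) u x = 0 →
      ∀ e ∈ IsManifold.maximalAtlas (𝓡 n) ∞ M, x ∈ e.source →
        (hessian (u ∘ e.symm) (e x)).det ≠ 0

end EllipticOp

end

open scoped Manifold ContDiff Matrix
open Set Filter Topology

/-! The balls of a locally finite cover by coordinate balls, joined when they overlap, form an
infinite, connected, locally finite graph. `exists_potential` puts on it a function `φ` that has a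
smaller value at some neighbour of every vertex, but along which no infinite walk increases: the
least cost of an infinite walk, for positive summable vertex weights.

On each ball, `BallCover.exists_pushing` gives a nonnegative bump `α k` with `A (α k) ≥ α k` off a
prescribed open set, which is taken to be the overlap with a neighbour of smaller potential. Among
the balls containing `x` let `i` have least potential. Then `x` is not in the bad set of `i`, and
every `j` whose bad set contains `x` is a neighbour of `i` with `φ i < φ j`. This relation is well
founded with finitely many predecessors, so coefficients `C` can be chosen recursively
(`exists_dominating`) such that the term of `i` beats all bad terms and any prescribed bound. Hence
`∑ C i * α i` and its image under `A` exceed any given locally bounded function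
(`BallCover.exists_subsolution`).

To get a Morse function, add cut-off coordinate functions with coefficients in `[-1, 1]`.
Nondegeneracy on one closed ball is an open condition on the coefficients (compactness) and a dense
one (Sard's theorem for the gradient), so Baire's theorem in the cube of coefficients applies. All
these perturbations have one common locally bounded size, which is added to `ρ` before the
subsolution is built. -/

namespace EllipticOp

/-! ### Infinite walks and potentials on locally finite graphs -/

section Walks

open scoped ENNReal

variable {V : Type*} {Adj : V → V → Prop}

/-- The vertices that can be reached from `v` by steps along `Adj` which avoid `S`. -/
def reach (Adj : V → V → Prop) (S : Set V) (v : V) : Set V :=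
  {u | Relation.ReflTransGen (fun a b => Adj a b ∧ b ∉ S) v u}

/-- After its last visit to `v`, a walk avoids `v` and starts at a neighbour of `v`. -/
theorem reach_subset (S : Set V) (v : V) :
    reach Adj S v ⊆ insert v (⋃ v' ∈ {v' | Adj v v' ∧ v' ∉ insert v S}, reach Adj (insert v S) v') := by
  intro u hu
  induction hu with
  | refl => exact mem_insert _ _
  | @tail b c hvb hbc ih =>
    by_cases hc : c = v
    · exact hc ▸ mem_insert _ _
    have hc' : c ∉ insert v S := by simp [hc, hbc.2]
    refine mem_insert_of_mem _ ?_
    rcases ih with rfl | ih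
    · simp only [mem_iUnion]
      exact ⟨c, ⟨hbc.1, hc'⟩, Relation.ReflTransGen.refl⟩
    · simp only [mem_iUnion] at ih ⊢
      obtain ⟨v', hv', h⟩ := ih
      exact ⟨v', hv', h.tail ⟨hbc.1, hc'⟩⟩

theorem exists_reach_infinite (hfin : ∀ i, {j | Adj i j}.Finite) {S : Set V} {v : V}
    (h : (reach Adj S v).Infinite) :
    ∃ v', Adj v v' ∧ v' ∉ insert v S ∧ (reach Adj (insert v S) v').Infinite := by
  by_contra! hcon
  refine h (Finite.subset (Finite.insert v (Finite.biUnion ((hfin v).subset ?_) ?_))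
    (reach_subset S v))
  · exact fun v' hv' => hv'.1
  · exact fun v' hv' => hcon v' hv'.1 hv'.2

/-- Kőnig's lemma: in an infinite, connected and locally finite graph, an injective walk starts
at every vertex. -/
theorem exists_injective_walk [Infinite V] (hfin : ∀ i, {j | Adj i j}.Finite)
    (hconn : ∀ i j, Relation.ReflTransGen Adj i j) (k : V) :
    ∃ r : ℕ → V, r 0 = k ∧ (∀ m, Adj (r m) (r (m + 1))) ∧ Function.Injective r := by
  -- A state records the vertices already used and the current one; the invariant is that infinitely
  -- many vertices remain reachable without the used ones.
  let St := {p : Set V × V // p.2 ∉ p.1 ∧ (reach Adj p.1 p.2).Infinite}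
  have hstep : ∀ p : St, ∃ q : St, Adj p.1.2 q.1.2 ∧ q.1.1 = insert p.1.2 p.1.1 := fun p => by
    obtain ⟨v', h1, h2, h3⟩ := exists_reach_infinite hfin p.2.2
    exact ⟨⟨(insert p.1.2 p.1.1, v'), h2, h3⟩, h1, rfl⟩
  choose nxt hadj hset using hstep
  have h0 : (reach Adj ∅ k).Infinite := by
    have : reach Adj ∅ k = univ := by
      ext u
      simpa [reach] using hconn k u
    rw [this]
    exact infinite_univ
  let st : ℕ → St := fun m => nxt^[m] ⟨(∅, k), by simp, h0⟩
  have hst : ∀ m, st (m + 1) = nxt (st m) := fun m => Function.iterate_succ_apply' _ _ _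
  have hmem : ∀ m l, m < l → (st m).1.2 ∈ (st l).1.1 := by
    intro m l hml
    induction l, hml using Nat.le_induction with
    | base => rw [hst, hset]; exact mem_insert _ _
    | succ l _ ih => rw [hst, hset]; exact mem_insert_of_mem _ ih
  refine ⟨fun m => (st m).1.2, rfl, fun m => ?_, fun m l hml => ?_⟩
  · simp only [hst]
    exact hadj _
  · rcases lt_trichotomy m l with h | h | h
    · have hml' : (st m).1.2 = (st l).1.2 := hml
      exact absurd (hml' ▸ hmem m l h) (st l).2.1
    · exact h
    · have hml' : (st m).1.2 = (st l).1.2 := hml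
      exact absurd (hml' ▸ hmem l m h) (st m).2.1

/-- On an infinite, connected, locally finite graph there is a function without local minima such
that no infinite walk moves against it. -/
theorem exists_potential [Countable V] [Infinite V] (hsymm : ∀ i j, Adj i j → Adj j i)
    (hfin : ∀ i, {j | Adj i j}.Finite) (hconn : ∀ i j, Relation.ReflTransGen Adj i j) :
    ∃ φ : V → ℝ≥0∞, (∀ i, ∃ j, Adj i j ∧ φ j < φ i) ∧
      WellFounded fun j i => Adj j i ∧ φ i < φ j := by
  obtain ⟨w, hw, hsum⟩ := ENNReal.exists_pos_sum_of_countable (ε := 1) one_ne_zero V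
  let Walk : V → Type _ := fun k => {r : ℕ → V // r 0 = k ∧ ∀ m, Adj (r m) (r (m + 1))}
  -- The cheapest way to walk forever from `k`. Repeated vertices are paid for again; an injective
  -- walk costs less than 1, so `φ` is finite.
  let φ : V → ℝ≥0∞ := fun k => ⨅ r : Walk k, ∑' m, (w (r.1 m) : ℝ≥0∞)
  have hinj : ∀ r : ℕ → V, Function.Injective r → ∑' m, (w (r m) : ℝ≥0∞) < 1 := fun r hr =>
    (ENNReal.tsum_comp_le_tsum_of_injective hr (fun v => (w v : ℝ≥0∞))).trans_lt hsum
  have hφ : ∀ k, φ k < 1 := fun k => by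
    obtain ⟨r, h0, hr, hi⟩ := exists_injective_walk hfin hconn k
    exact (iInf_le (fun r : Walk k => ∑' m, (w (r.1 m) : ℝ≥0∞)) ⟨r, h0, hr⟩).trans_lt (hinj r hi)
  refine ⟨φ, fun i => ?_, ?_⟩
  · by_contra! hcon
    -- A walk from `i` pays `w i` and then at least the potential of its second vertex, which is no
    -- smaller than `φ i` at a local minimum.
    have h : (w i : ℝ≥0∞) + φ i ≤ φ i := by
      refine le_iInf fun r => ?_
      rw [tsum_eq_zero_add' ENNReal.summable, r.2.1]
      gcongr
      have h1 := r.2.2 0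
      rw [r.2.1] at h1
      refine (hcon (r.1 1) h1).trans ?_
      exact iInf_le (fun r' : Walk (r.1 1) => ∑' m, (w (r'.1 m) : ℝ≥0∞))
        ⟨fun m => r.1 (m + 1), rfl, fun m => r.2.2 (m + 1)⟩
    have h' : φ i < w i + φ i := by
      rw [add_comm]
      exact ENNReal.lt_add_right ((hφ i).trans ENNReal.one_lt_top).ne (by simpa using (hw i).ne')
    exact absurd h (not_le.2 h')
  · rw [wellFounded_iff_isEmpty_descending_chain]
    refine ⟨fun ⟨x, hx⟩ => ?_⟩
    have hmono : StrictMono fun m => φ (x m) := strictMono_nat_of_lt_succ fun m => (hx m).2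
    have hxi : Function.Injective x := fun a b hab => hmono.injective (by simp [hab])
    -- The tails of the chain are themselves walks, so `φ (x m)` is at most a tail of a convergent
    -- series and tends to 0, although it increases from a positive value.
    have htail := ENNReal.tendsto_sum_nat_add (fun m => (w (x m) : ℝ≥0∞))
      ((hinj x hxi).trans ENNReal.one_lt_top).ne
    have hle : ∀ m, φ (x m) ≤ ∑' l, (w (x (l + m)) : ℝ≥0∞) := fun m =>
      iInf_le (fun r : Walk (x m) => ∑' l, (w (r.1 l) : ℝ≥0∞))
        ⟨fun l => x (l + m), by simp, fun l => by
          have := hsymm _ _ (hx (l + m)).1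
          rwa [add_right_comm] at this⟩
    have hpos : 0 < φ (x 1) := (zero_le).trans_lt (hx 0).2
    have hev := (tendsto_order.1 htail).2 _ hpos
    obtain ⟨m, hm, h1⟩ := (hev.and (eventually_ge_atTop 1)).exists
    exact absurd ((hmono.monotone h1).trans (hle m)) (not_le.2 hm)

end Walks

/-! ### Hessians, Sard's theorem for gradients, quadratic forms -/

section Calculus

variable {n : ℕ}

local notation "𝔼" => EuclideanSpace ℝ (Fin n)

theorem partialDeriv_congr {f g : 𝔼 → ℝ} {y : 𝔼} (h : f =ᶠ[𝓝 y] g) (i : Fin n) :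
    partialDeriv i f =ᶠ[𝓝 y] partialDeriv i g := by
  filter_upwards [h.fderiv (𝕜 := ℝ)] with z hz
  simp [partialDeriv, hz]

theorem hessian_congr {f g : 𝔼 → ℝ} {y : 𝔼} (h : f =ᶠ[𝓝 y] g) : hessian f y = hessian g y := by
  ext i j
  exact (partialDeriv_congr (partialDeriv_congr h j) i).self_of_nhds

theorem ContDiffAt.partialDeriv {f : 𝔼 → ℝ} {y : 𝔼} {m k : ℕ∞ω} (hf : ContDiffAt ℝ k f y)
    (hmk : m + 1 ≤ k) (i : Fin n) : ContDiffAt ℝ m (partialDeriv i f) y :=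
  (hf.fderiv_right hmk).clm_apply contDiffAt_const

theorem partialDeriv_sum {ι : Type*} (J : Finset ι) (t : ι → ℝ) {f : ι → 𝔼 → ℝ} {y : 𝔼}
    (hf : ∀ j ∈ J, DifferentiableAt ℝ (f j) y) (i : Fin n) :
    partialDeriv i (fun z => ∑ j ∈ J, t j * f j z) y = ∑ j ∈ J, t j * partialDeriv i (f j) y := by
  have h : HasFDerivAt (fun z => ∑ j ∈ J, t j * f j z) (∑ j ∈ J, t j • fderiv ℝ (f j) y) y :=
    HasFDerivAt.fun_sum fun j hj => (hf j hj).hasFDerivAt.const_mul (t j)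
  simp [partialDeriv, h.fderiv]

theorem hessian_sum {ι : Type*} (J : Finset ι) (t : ι → ℝ) {f : ι → 𝔼 → ℝ} {y : 𝔼}
    (hf : ∀ j ∈ J, ContDiffAt ℝ 2 (f j) y) (a b : Fin n) :
    hessian (fun z => ∑ j ∈ J, t j * f j z) y a b = ∑ j ∈ J, t j * hessian (f j) y a b := by
  have hev : ∀ᶠ z in 𝓝 y, ∀ j ∈ J, ContDiffAt ℝ 2 (f j) z :=
    (Finset.eventually_all J).2 fun j hj => (hf j hj).eventually (by simp)
  have h : partialDeriv b (fun z => ∑ j ∈ J, t j * f j z)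
      =ᶠ[𝓝 y] fun z => ∑ j ∈ J, t j * partialDeriv b (f j) z := by
    filter_upwards [hev] with z hz
    exact partialDeriv_sum J t (fun j hj => (hz j hj).differentiableAt (by simp)) b
  have h2 := (partialDeriv_congr h a).self_of_nhds
  simp only [hessian, Matrix.of_apply]
  rw [h2]
  exact partialDeriv_sum J t
    (fun j hj => (ContDiffAt.partialDeriv (m := 1) (hf j hj) (by norm_num) b).differentiableAt
      (by simp)) a

theorem hessian_apply {f : 𝔼 → ℝ} {y : 𝔼} (hf : ContDiffAt ℝ 2 f y) (i j : Fin n) :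
    hessian f y i j = fderiv ℝ (fderiv ℝ f) y (EuclideanSpace.single i 1)
      (EuclideanSpace.single j 1) := by
  have h : DifferentiableAt ℝ (fderiv ℝ f) y :=
    (hf.fderiv_right (m := 1) (by norm_num)).differentiableAt (by simp)
  have h' := h.hasFDerivAt.clm_apply (hasFDerivAt_const (EuclideanSpace.single j (1 : ℝ)) y)
  simp only [hessian, Matrix.of_apply]
  unfold partialDeriv
  rw [h'.fderiv]
  simp

theorem sum_coord_smul_single (v : 𝔼) :
    ∑ i, v i • EuclideanSpace.single i (1 : ℝ) = v := by
  ext j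
  simp [Pi.single_apply]

/-- This coordinate-free form of degeneracy serves both the change of charts and Sard's theorem. -/
theorem det_hessian_eq_zero_iff {f : 𝔼 → ℝ} {y : 𝔼} (hf : ContDiffAt ℝ 2 f y) :
    (hessian f y).det = 0 ↔ ∃ v : 𝔼, v ≠ 0 ∧ ∀ w, fderiv ℝ (fderiv ℝ f) y v w = 0 := by
  have key : ∀ v : 𝔼, (v.ofLp ᵥ* hessian f y = 0) ↔ ∀ w, fderiv ℝ (fderiv ℝ f) y v w = 0 := by
    intro v
    have h1 : ∀ j, (v.ofLp ᵥ* hessian f y) j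
        = fderiv ℝ (fderiv ℝ f) y v (EuclideanSpace.single j 1) := by
      intro j
      conv_rhs => rw [← sum_coord_smul_single v]
      simp [Matrix.vecMul, dotProduct, hessian_apply hf, map_sum]
    constructor
    · intro h w
      rw [← sum_coord_smul_single w, map_sum]
      refine Finset.sum_eq_zero fun j _ => ?_
      rw [map_smul, ← h1, h]
      simp
    · intro h
      ext j
      rw [h1, h]
      rfl
  rw [← Matrix.exists_vecMul_eq_zero_iff]
  constructor
  · rintro ⟨v, hv, h⟩
    exact ⟨WithLp.toLp 2 v, by simpa using hv, (key _).1 h⟩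
  · rintro ⟨v, hv, h⟩
    exact ⟨v.ofLp, by simpa using hv, (key _).2 h⟩

/-- Nondegeneracy of a critical point is invariant under a change of coordinates. -/
theorem det_hessian_comp_ne_zero {g : 𝔼 → ℝ} {τ σ : 𝔼 → 𝔼} {y : 𝔼} (hg : ContDiffAt ℝ 2 g (τ y))
    (hτ : ContDiffAt ℝ 2 τ y) (hσ : DifferentiableAt ℝ σ (τ y))
    (hστ : ∀ᶠ z in 𝓝 y, σ (τ z) = z) (hcrit : fderiv ℝ g (τ y) = 0)
    (hdet : (hessian g (τ y)).det ≠ 0) : (hessian (g ∘ τ) y).det ≠ 0 := by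
  have hτd : DifferentiableAt ℝ τ y := hτ.differentiableAt (by simp)
  have hgd : DifferentiableAt ℝ (fderiv ℝ g) (τ y) :=
    (hg.fderiv_right (m := 1) (by norm_num)).differentiableAt (by simp)
  have hτdd : DifferentiableAt ℝ (fderiv ℝ τ) y :=
    (hτ.fderiv_right (m := 1) (by norm_num)).differentiableAt (by simp)
  set J := fderiv ℝ τ y with hJ
  -- The chain rule for `σ ∘ τ = id` gives `J` a left inverse.
  have hinj : Function.Injective J := by
    have h1 : HasFDerivAt (fun z => σ (τ z)) ((fderiv ℝ σ (τ y)).comp J) y :=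
      hσ.hasFDerivAt.comp y hτd.hasFDerivAt
    have h2 : HasFDerivAt (fun z => σ (τ z)) (ContinuousLinearMap.id ℝ 𝔼) y :=
      (hasFDerivAt_id y).congr_of_eventuallyEq hστ
    have h3 := h1.unique h2
    intro a b hab
    have ha : fderiv ℝ σ (τ y) (J a) = a := congrArg (fun L : 𝔼 →L[ℝ] 𝔼 => L a) h3
    have hb : fderiv ℝ σ (τ y) (J b) = b := congrArg (fun L : 𝔼 →L[ℝ] 𝔼 => L b) h3
    rw [← ha, ← hb, hab]
  have hsurj : Function.Surjective J :=
    (LinearMap.injective_iff_surjective (f := (J : 𝔼 →ₗ[ℝ] 𝔼))).1 hinj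
  have hD : fderiv ℝ (g ∘ τ) =ᶠ[𝓝 y] fun z => (fderiv ℝ g (τ z)).comp (fderiv ℝ τ z) := by
    have e1 : ∀ᶠ z in 𝓝 y, DifferentiableAt ℝ g (τ z) :=
      hτ.continuousAt.eventually ((hg.eventually (by simp)).mono fun z hz =>
        hz.differentiableAt (by simp))
    have e2 : ∀ᶠ z in 𝓝 y, DifferentiableAt ℝ τ z :=
      (hτ.eventually (by simp)).mono fun z hz => hz.differentiableAt (by simp)
    filter_upwards [e1, e2] with z h1 h2 using fderiv_comp z h1 h2
  -- The term with the second derivative of `τ` is multiplied by the first derivative of `g`, which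
  -- vanishes at the critical point.
  have hDD : ∀ v w, fderiv ℝ (fderiv ℝ (g ∘ τ)) y v w
      = fderiv ℝ (fderiv ℝ g) (τ y) (J v) (J w) := by
    intro v w
    rw [hD.fderiv_eq]
    have h0 : HasFDerivAt (fun z => fderiv ℝ g (τ z)) ((fderiv ℝ (fderiv ℝ g) (τ y)).comp J) y :=
      hgd.hasFDerivAt.comp y hτd.hasFDerivAt
    rw [(h0.clm_comp hτdd.hasFDerivAt).fderiv]
    simp [hcrit, ← hJ]
  intro h0
  obtain ⟨v, hv, hvw⟩ := (det_hessian_eq_zero_iff (hg.comp y hτ)).1 h0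
  refine hdet ((det_hessian_eq_zero_iff hg).2 ⟨J v, fun h => hv (hinj (by simp [h])), fun w => ?_⟩)
  obtain ⟨u, rfl⟩ := hsurj w
  rw [← hDD, hvw]

/-- Sard's theorem for the gradient: almost every linear perturbation of a smooth function has
only nondegenerate critical points. -/
theorem ae_nondegenerate {U : Set 𝔼} {f : 𝔼 → ℝ} (hf : ∀ y ∈ U, ContDiffAt ℝ 3 f y) :
    ∀ᵐ τ : 𝔼, ∀ y ∈ U, (∀ i, partialDeriv i f y + τ i = 0) → (hessian f y).det ≠ 0 := by
  -- Critical points of `f + ⟨τ, ·⟩` are the solutions of `G y = τ`, and the derivative of `G` is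
  -- singular exactly where the Hessian of `f` is. So the bad `τ` are critical values of `G`.
  let G : 𝔼 → 𝔼 := fun y => WithLp.toLp 2 fun i => -partialDeriv i f y
  let Z : Set 𝔼 := {y ∈ U | (hessian f y).det = 0}
  have hG : ∀ y ∈ U, DifferentiableAt ℝ G y := fun y hy => by
    rw [differentiableAt_euclidean]
    exact fun i => ((ContDiffAt.partialDeriv (m := 2) (hf y hy) (by norm_num) i).differentiableAt
      (by simp)).neg
  have h0 : MeasureTheory.volume (G '' Z) = 0 := by
    refine MeasureTheory.addHaar_image_eq_zero_of_det_fderivWithin_eq_zero _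
      (f' := fun y => fderiv ℝ G y)
      (fun y hy => (hG y hy.1).hasFDerivAt.hasFDerivWithinAt) fun y hy => ?_
    have hf2 : ContDiffAt ℝ 2 f y := (hf y hy.1).of_le (by norm_num)
    obtain ⟨v, hv, hvw⟩ := (det_hessian_eq_zero_iff hf2).1 hy.2
    have hker : fderiv ℝ G y v = 0 := by
      ext i
      have h1 := (EuclideanSpace.proj i : 𝔼 →L[ℝ] ℝ).hasFDerivAt.comp y (hG y hy.1).hasFDerivAt
      have hdd : DifferentiableAt ℝ (fderiv ℝ f) y :=
        (hf2.fderiv_right (m := 1) (by norm_num)).differentiableAt (by simp)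
      have h2 := (hdd.hasFDerivAt.clm_apply
        (hasFDerivAt_const (EuclideanSpace.single i (1 : ℝ)) y)).neg
      have h3 := congrArg (fun L : 𝔼 →L[ℝ] ℝ => L v) (h1.unique h2)
      simpa [hvw] using h3
    refine LinearMap.det_eq_zero_iff_ker_ne_bot.2 fun hbot => hv ?_
    exact (Submodule.eq_bot_iff _).1 hbot v hker
  have h1 : ∀ᵐ τ : 𝔼, τ ∉ G '' Z := MeasureTheory.measure_eq_zero_iff_ae_notMem.1 h0
  filter_upwards [h1] with τ hτ y hy hcrit hdet
  refine hτ ⟨y, ⟨hy, hdet⟩, ?_⟩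
  ext i
  have := hcrit i
  simp only [G]
  linarith

/-- A symmetric matrix whose eigenvalues are at least `δ` has quadratic form at least
`δ * ‖z‖ ^ 2`. -/
theorem le_sum_of_le_eigenvalues {a : Matrix (Fin n) (Fin n) ℝ} (ha : a.IsSymm) {δ : ℝ}
    (h : ∀ μ : ℝ, Module.End.HasEigenvalue (Matrix.toLin' a) μ → δ ≤ μ) (z : Fin n → ℝ) :
    δ * ∑ i, z i ^ 2 ≤ ∑ i, ∑ j, a i j * (z i * z j) := by
  have hH : (a - δ • (1 : Matrix (Fin n) (Fin n) ℝ)).IsHermitian := by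
    have : a.IsHermitian := by
      rw [Matrix.IsHermitian, Matrix.conjTranspose_eq_transpose_of_trivial]; exact ha
    refine this.sub ?_
    rw [Matrix.IsHermitian, Matrix.conjTranspose_eq_transpose_of_trivial]; simp
  have hpos : (a - δ • (1 : Matrix (Fin n) (Fin n) ℝ)).PosSemidef := by
    rw [hH.posSemidef_iff_eigenvalues_nonneg]
    intro i
    have hv := hH.mulVec_eigenvectorBasis i
    have hne : (hH.eigenvectorBasis i).ofLp ≠ 0 := by
      have := hH.eigenvectorBasis.orthonormal.ne_zero i
      simpa using this
    have := h (hH.eigenvalues i + δ) (Module.End.hasEigenvalue_of_hasEigenvector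
      (x := (hH.eigenvectorBasis i).ofLp) ⟨?_, hne⟩)
    · simpa using this
    · rw [Module.End.mem_eigenspace_iff, Matrix.toLin'_apply]
      rw [Matrix.sub_mulVec, Matrix.smul_mulVec, Matrix.one_mulVec] at hv
      rw [add_smul, ← hv]
      simp
  have hq := hpos.dotProduct_mulVec_nonneg z
  have : star z ⬝ᵥ (a - δ • (1 : Matrix (Fin n) (Fin n) ℝ)) *ᵥ z
      = ∑ i, ∑ j, a i j * (z i * z j) - δ * ∑ i, z i ^ 2 := by
    rw [Matrix.sub_mulVec, Matrix.smul_mulVec, Matrix.one_mulVec]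
    simp only [dotProduct, Matrix.mulVec, star_trivial, Pi.sub_apply, Pi.smul_apply, smul_eq_mul,
      mul_sub, Finset.sum_sub_distrib, Finset.mul_sum]
    congr 1
    · exact Finset.sum_congr rfl fun i _ => Finset.sum_congr rfl fun j _ => by ring
    · exact Finset.sum_congr rfl fun i _ => by ring
  linarith

end Calculus

/-! ### Local bounds made uniform on compact sets -/

section LocallyBounded

variable {M : Type*} [TopologicalSpace M]

theorem LocallyBoundedOn.exists_bound {f : M → ℝ} {s K : Set M} (hf : LocallyBoundedOn f s)
    (hK : IsCompact K) (hKs : K ⊆ s) : ∃ C : ℝ, 0 ≤ C ∧ ∀ x ∈ K, |f x| ≤ C := by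
  refine hK.induction_on (p := fun K => ∃ C : ℝ, 0 ≤ C ∧ ∀ x ∈ K, |f x| ≤ C)
    ⟨0, le_rfl, by simp⟩ ?_ ?_ ?_
  · rintro s t hst ⟨C, h0, hC⟩
    exact ⟨C, h0, fun x hx => hC x (hst hx)⟩
  · rintro s t ⟨C, h0, hC⟩ ⟨D, h0', hD⟩
    refine ⟨max C D, le_max_of_le_left h0, fun x hx => ?_⟩
    rcases hx with hx | hx
    · exact (hC x hx).trans (le_max_left _ _)
    · exact (hD x hx).trans (le_max_right _ _)
  · intro x hx
    obtain ⟨C, hC⟩ := hf x (hKs hx)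
    exact ⟨_, mem_nhdsWithin_of_mem_nhds hC, max C 0, le_max_right _ _,
      fun y hy => le_max_of_le_left hy⟩

theorem LocallyBoundedOn.add {f g : M → ℝ} {s : Set M} (hf : LocallyBoundedOn f s)
    (hg : LocallyBoundedOn g s) : LocallyBoundedOn (fun x => f x + g x) s := fun x hx => by
  obtain ⟨C, hC⟩ := hf x hx
  obtain ⟨D, hD⟩ := hg x hx
  exact ⟨C + D, by filter_upwards [hC, hD] with y h1 h2 using
    (abs_add_le _ _).trans (add_le_add h1 h2)⟩

theorem LocallyBoundedOn.mul {f g : M → ℝ} {s : Set M} (hf : LocallyBoundedOn f s)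
    (hg : LocallyBoundedOn g s) : LocallyBoundedOn (fun x => f x * g x) s := fun x hx => by
  obtain ⟨C, hC⟩ := hf x hx
  obtain ⟨D, hD⟩ := hg x hx
  refine ⟨C * D, ?_⟩
  filter_upwards [hC, hD] with y h1 h2
  rw [abs_mul]
  exact mul_le_mul h1 h2 (abs_nonneg _) ((abs_nonneg _).trans h1)

theorem LocallyBoundedOn.sum {ι : Type*} (J : Finset ι) {f : ι → M → ℝ} {s : Set M}
    (hf : ∀ j ∈ J, LocallyBoundedOn (f j) s) : LocallyBoundedOn (fun x => ∑ j ∈ J, f j x) s := by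
  classical
  induction J using Finset.induction_on with
  | empty => exact fun x _ => ⟨0, by simp⟩
  | insert a J ha ih =>
    simp only [Finset.sum_insert ha]
    exact (hf a (by simp)).add (ih fun j hj => hf j (Finset.mem_insert_of_mem hj))

theorem LocallyBoundedOn.of_continuousAt {f : M → ℝ} {s : Set M} (hf : ∀ x ∈ s, ContinuousAt f x) :
    LocallyBoundedOn f s := fun x hx =>
  ⟨|f x| + 1, ((hf x hx).abs.eventually_lt_const (lt_add_one _)).mono fun _ h => le_of_lt h⟩

theorem EigenvaluesLocallyBoundedBelowOn.exists_bound {n : ℕ} {a : M → Matrix (Fin n) (Fin n) ℝ}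
    {s K : Set M} (ha : EigenvaluesLocallyBoundedBelowOn a s) (hK : IsCompact K) (hKs : K ⊆ s) :
    ∃ δ : ℝ, 0 < δ ∧ ∀ x ∈ K, ∀ μ : ℝ,
      Module.End.HasEigenvalue (Matrix.toLin' (a x)) μ → δ ≤ μ := by
  refine hK.induction_on (p := fun K => ∃ δ : ℝ, 0 < δ ∧ ∀ x ∈ K, ∀ μ : ℝ,
      Module.End.HasEigenvalue (Matrix.toLin' (a x)) μ → δ ≤ μ) ⟨1, one_pos, by simp⟩ ?_ ?_ ?_
  · rintro s t hst ⟨C, h0, hC⟩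
    exact ⟨C, h0, fun x hx => hC x (hst hx)⟩
  · rintro s t ⟨C, h0, hC⟩ ⟨D, h0', hD⟩
    refine ⟨min C D, lt_min h0 h0', fun x hx μ hμ => ?_⟩
    rcases hx with hx | hx
    · exact (min_le_left _ _).trans (hC x hx μ hμ)
    · exact (min_le_right _ _).trans (hD x hx μ hμ)
  · intro x hx
    obtain ⟨δ, h0, h⟩ := ha x (hKs hx)
    exact ⟨_, mem_nhdsWithin_of_mem_nhds h, δ, h0, fun y hy => hy⟩

end LocallyBounded

theorem two_le_infty : (2 : ℕ∞ω) ≤ ∞ :=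
  WithTop.coe_le_coe.2 (le_top : (2 : ℕ∞) ≤ ⊤)

theorem three_le_infty : (3 : ℕ∞ω) ≤ ∞ :=
  WithTop.coe_le_coe.2 (le_top : (3 : ℕ∞) ≤ ⊤)

/-! ### Extension from charts; locality and linearity of the operator -/

section Operator

set_option linter.unusedSectionVars false

variable {n : ℕ} {M : Type*} [TopologicalSpace M] [ChartedSpace (EuclideanSpace ℝ (Fin n)) M]

local notation "𝔼" => EuclideanSpace ℝ (Fin n)

theorem contDiffAt_comp_symm [IsManifold (𝓡 n) ∞ M] {e : OpenPartialHomeomorph M 𝔼}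
    (he : e ∈ IsManifold.maximalAtlas (𝓡 n) ∞ M) {u : M → ℝ} {k : ℕ∞} (hu : ContMDiff (𝓡 n) 𝓘(ℝ, ℝ) k u)
    {y : 𝔼} (hy : y ∈ e.target) : ContDiffAt ℝ k (u ∘ e.symm) y := by
  have h1 : ContMDiffAt (𝓡 n) (𝓡 n) k e.symm y :=
    ((contMDiffOn_symm_of_mem_maximalAtlas he).contMDiffAt (e.open_target.mem_nhds hy)).of_le
      (by exact_mod_cast le_top)
  exact contMDiffAt_iff_contDiffAt.1 (hu.contMDiffAt.comp y h1)

/-- The function `g` on a chart, extended by zero to the manifold. -/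
noncomputable def extend (e : OpenPartialHomeomorph M 𝔼) (g : 𝔼 → ℝ) : M → ℝ :=
  e.source.indicator (g ∘ e)

theorem extend_of_mem {e : OpenPartialHomeomorph M 𝔼} (g : 𝔼 → ℝ) {x : M} (hx : x ∈ e.source) :
    extend e g x = g (e x) := indicator_of_mem hx _

theorem extend_eq_zero {e : OpenPartialHomeomorph M 𝔼} {g : 𝔼 → ℝ} {K : Set 𝔼}
    (hg : ∀ y ∉ K, g y = 0) {x : M} (hx : x ∉ e.symm '' K) : extend e g x = 0 := by
  by_cases h : x ∈ e.source
  · rw [extend_of_mem g h]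
    exact hg _ fun hK => hx ⟨e x, hK, e.left_inv h⟩
  · exact indicator_of_notMem h _

theorem extend_comp_symm (e : OpenPartialHomeomorph M 𝔼) (g : 𝔼 → ℝ) {y : 𝔼} (hy : y ∈ e.target) :
    extend e g ∘ e.symm =ᶠ[𝓝 y] g := by
  filter_upwards [e.open_target.mem_nhds hy] with z hz
  simp [extend_of_mem g (e.map_target hz), e.right_inv hz]

theorem isCompact_symm_image {e : OpenPartialHomeomorph M 𝔼} {K : Set 𝔼} (hK : IsCompact K)
    (hKt : K ⊆ e.target) : IsCompact (e.symm '' K) :=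
  hK.image_of_continuousOn (e.continuousOn_symm.mono hKt)

/-- The compact image of `K` is closed in the Hausdorff space `M`, so the extension vanishes near
every point outside the chart domain. -/
theorem contMDiff_extend [IsManifold (𝓡 n) ∞ M] [T2Space M] {e : OpenPartialHomeomorph M 𝔼}
    (he : e ∈ IsManifold.maximalAtlas (𝓡 n) ∞ M) {g : 𝔼 → ℝ} (hgs : ContDiff ℝ ∞ g)
    {K : Set 𝔼} (hK : IsCompact K) (hKt : K ⊆ e.target) (hg : ∀ y ∉ K, g y = 0) :
    ContMDiff (𝓡 n) 𝓘(ℝ, ℝ) ∞ (extend e g) := by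
  intro x
  by_cases h : x ∈ e.source
  · have h1 : ContMDiffAt (𝓡 n) (𝓡 n) ∞ e x :=
      (contMDiffOn_of_mem_maximalAtlas he).contMDiffAt (e.open_source.mem_nhds h)
    refine (hgs.contMDiff.contMDiffAt.comp x h1).congr_of_eventuallyEq ?_
    filter_upwards [e.open_source.mem_nhds h] with z hz using extend_of_mem g hz
  · have h1 : (e.symm '' K)ᶜ ∈ 𝓝 x := by
      refine (isCompact_symm_image hK hKt).isClosed.isOpen_compl.mem_nhds ?_
      rintro ⟨y, hy, rfl⟩
      exact h (e.map_target (hKt hy))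
    refine (contMDiffAt_const (c := (0 : ℝ))).congr_of_eventuallyEq ?_
    filter_upwards [h1] with z hz using extend_eq_zero hg hz

/-- In a chart, `A u x` depends linearly on the 2-jet of `u` at `x`. Assuming equality only near `x`
combines locality with linearity and makes `A` computable on locally finite sums. -/
theorem IsLocallyUniformlyElliptic.apply_eq_sum [IsManifold (𝓡 n) ∞ M] {A : (M → ℝ) → M → ℝ}
    (hA : IsLocallyUniformlyElliptic n A) {ι : Type*} (J : Finset ι) (t : ι → ℝ) {f : ι → M → ℝ}
    (hf : ∀ j ∈ J, ContMDiff (𝓡 n) 𝓘(ℝ, ℝ) ∞ (f j)) {u : M → ℝ}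
    (hu : ContMDiff (𝓡 n) 𝓘(ℝ, ℝ) ∞ u) {x : M} (hx : u =ᶠ[𝓝 x] fun z => ∑ j ∈ J, t j * f j z) :
    A u x = ∑ j ∈ J, t j * A (f j) x := by
  have he : chartAt 𝔼 x ∈ IsManifold.maximalAtlas (𝓡 n) ∞ M := IsManifold.chart_mem_maximalAtlas x
  set e := chartAt 𝔼 x
  have hxe : x ∈ e.source := mem_chart_source 𝔼 x
  have hxt : e x ∈ e.target := e.map_source hxe
  obtain ⟨a, b, c, -, -, -, -, -, hform⟩ := hA e he
  have h2 : ∀ v : M → ℝ, ContMDiff (𝓡 n) 𝓘(ℝ, ℝ) ∞ v → ContMDiff (𝓡 n) 𝓘(ℝ, ℝ) 2 v :=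
    fun v hv => hv.of_le two_le_infty
  have hcd : ∀ j ∈ J, ContDiffAt ℝ 2 (f j ∘ e.symm) (e x) := fun j hj =>
    (contDiffAt_comp_symm (k := 2) he (h2 _ (hf j hj)) hxt)
  have hev : u ∘ e.symm =ᶠ[𝓝 (e x)] fun y => ∑ j ∈ J, t j * (f j ∘ e.symm) y := by
    have := (e.continuousAt_symm hxt).tendsto
    rw [e.left_inv hxe] at this
    exact this.eventually hx
  rw [hform u (h2 u hu) x hxe, hessian_congr hev, hx.self_of_nhds]
  have h3 : ∀ i, partialDeriv i (u ∘ e.symm) (e x)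
      = ∑ j ∈ J, t j * partialDeriv i (f j ∘ e.symm) (e x) := fun i => by
    rw [(partialDeriv_congr hev i).self_of_nhds]
    exact partialDeriv_sum J t (fun j hj => (hcd j hj).differentiableAt (by simp)) i
  simp only [h3, hessian_sum J t hcd]
  have hr : ∑ j ∈ J, t j * A (f j) x = ∑ j ∈ J, t j *
      (∑ i, ∑ l, a x i l * hessian (f j ∘ e.symm) (e x) i l
        + ∑ i, b x i * partialDeriv i (f j ∘ e.symm) (e x) + c x * f j x) :=
    Finset.sum_congr rfl fun j hj => by rw [hform (f j) (h2 _ (hf j hj)) x hxe]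
  rw [hr]
  simp only [mul_add, Finset.sum_add_distrib, Finset.mul_sum]
  congr 2
  · rw [Finset.sum_comm (s := J)]
    refine Finset.sum_congr rfl fun i _ => ?_
    rw [Finset.sum_comm (s := J)]
    exact Finset.sum_congr rfl fun l _ => Finset.sum_congr rfl fun j _ => by ring
  · rw [Finset.sum_comm (s := J)]
    exact Finset.sum_congr rfl fun l _ => Finset.sum_congr rfl fun j _ => by ring
  · ext j
    ring

theorem IsLocallyUniformlyElliptic.locallyBoundedOn_apply [IsManifold (𝓡 n) ∞ M]
    {A : (M → ℝ) → M → ℝ} (hA : IsLocallyUniformlyElliptic n A) {u : M → ℝ}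
    (hu : ContMDiff (𝓡 n) 𝓘(ℝ, ℝ) ∞ u) : LocallyBoundedOn (A u) univ := by
  intro x _
  have he : chartAt 𝔼 x ∈ IsManifold.maximalAtlas (𝓡 n) ∞ M := IsManifold.chart_mem_maximalAtlas x
  set e := chartAt 𝔼 x
  have hxe : x ∈ e.source := mem_chart_source 𝔼 x
  obtain ⟨a, b, c, ha, hb, hc, -, -, hform⟩ := hA e he
  have hcd : ∀ z ∈ e.source, ContDiffAt ℝ ∞ (u ∘ e.symm) (e z) := fun z hz =>
    contDiffAt_comp_symm (k := ⊤) he hu (e.map_source hz)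
  have hcont : ∀ g : 𝔼 → ℝ, (∀ z ∈ e.source, ContDiffAt ℝ ∞ g (e z)) →
      LocallyBoundedOn (fun z => g (e z)) e.source := fun g hg =>
    .of_continuousAt fun z hz => (hg z hz).continuousAt.comp (e.continuousAt hz)
  have hp : ∀ (g : 𝔼 → ℝ), (∀ z ∈ e.source, ContDiffAt ℝ ∞ g (e z)) → ∀ i,
      (∀ z ∈ e.source, ContDiffAt ℝ ∞ (partialDeriv i g) (e z)) := fun g hg i z hz =>
    (ContDiffAt.partialDeriv (hg z hz) (by simp) i)
  have key : LocallyBoundedOn (fun z =>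
      ∑ i, ∑ j, a z i j * hessian (u ∘ e.symm) (e z) i j
          + ∑ i, b z i * partialDeriv i (u ∘ e.symm) (e z) + c z * u z) e.source := by
    refine (LocallyBoundedOn.add ?_ ?_).add ?_
    · exact .sum _ fun i _ => .sum _ fun j _ => (ha i j).mul (hcont _ (hp _ (hp _ hcd j) i))
    · exact .sum _ fun i _ => (hb i).mul (hcont _ (hp _ hcd i))
    · exact hc.mul (.of_continuousAt fun z _ => hu.continuous.continuousAt)
  obtain ⟨C, hC⟩ := key x hxe
  refine ⟨C, ?_⟩
  filter_upwards [hC, e.open_source.mem_nhds hxe] with z hz hzs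
  rwa [hform u (hu.of_le two_le_infty) z hzs]

theorem IsLocallyUniformlyElliptic.apply_eq_zero [IsManifold (𝓡 n) ∞ M] {A : (M → ℝ) → M → ℝ}
    (hA : IsLocallyUniformlyElliptic n A) {u : M → ℝ} (hu : ContMDiff (𝓡 n) 𝓘(ℝ, ℝ) ∞ u)
    {W : Set M} (hW : IsClosed W) (huW : ∀ x ∉ W, u x = 0) {x : M} (hx : x ∉ W) : A u x = 0 := by
  -- Near `x` the function is an empty sum; the index type and the family are dummies.
  have := hA.apply_eq_sum (∅ : Finset ℕ) (fun _ => 0) (f := fun _ => u) (by simp) hu (x := x)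
    (by filter_upwards [hW.isOpen_compl.mem_nhds hx] with z hz; simp [huW z hz])
  simpa using this

end Operator

/-! ### Locally finite covers by coordinate balls and their nerves -/

section Cover

universe u

variable {n : ℕ} {M : Type u} [TopologicalSpace M] [ChartedSpace (EuclideanSpace ℝ (Fin n)) M]

local notation "𝔼" => EuclideanSpace ℝ (Fin n)

/-- A cover of a manifold by coordinate balls such that the concentric closed balls of three times
the radius form a locally finite family. -/
structure BallCover (n : ℕ) (M : Type u) [TopologicalSpace M]
    [ChartedSpace (EuclideanSpace ℝ (Fin n)) M] where
  ι : Type u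
  chart : ι → OpenPartialHomeomorph M (EuclideanSpace ℝ (Fin n))
  center : ι → EuclideanSpace ℝ (Fin n)
  radius : ι → ℝ
  chart_mem : ∀ k, chart k ∈ IsManifold.maximalAtlas (𝓡 n) ∞ M
  radius_pos : ∀ k, 0 < radius k
  subset_target : ∀ k, Metric.closedBall (center k) (3 * radius k) ⊆ (chart k).target
  exists_mem : ∀ x, ∃ k, x ∈ (chart k).symm '' Metric.ball (center k) (radius k)
  locallyFinite : LocallyFinite fun k =>
    (chart k).symm '' Metric.closedBall (center k) (3 * radius k)

/-- Take a locally finite open cover `U` inside compact sets and shrink it to compact sets `C a ⊆ U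
a` that still cover. Finitely many small balls cover `C a`, with tripled balls inside `U a`, so
local finiteness passes to the tripled balls. -/
theorem exists_ballCover [IsManifold (𝓡 n) ∞ M] [T2Space M] [SecondCountableTopology M] :
    Nonempty (BallCover n M) := by
  have : LocallyCompactSpace M := ChartedSpace.locallyCompactSpace 𝔼 M
  have hK : ∀ x : M, ∃ K : Set M, IsCompact K ∧ x ∈ interior K := fun x =>
    exists_compact_mem_nhds x |>.imp fun K h => ⟨h.1, mem_interior_iff_mem_nhds.2 h.2⟩
  choose K hKc hKx using hK
  obtain ⟨U, hUo, hUc, hUf, hUK⟩ := precise_refinement (fun x => interior (K x))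
    (fun x => isOpen_interior) (iUnion_eq_univ_iff.2 fun x => ⟨x, hKx x⟩)
  obtain ⟨C, hCc, hCcl, hCU⟩ := exists_iUnion_eq_closed_subset hUo (fun x => hUf.point_finite x) hUc
  have hCcomp : ∀ a, IsCompact (C a) := fun a => (hKc a).of_isClosed_subset (hCcl a)
    ((hCU a).trans ((hUK a).trans interior_subset))
  have hr : ∀ a x, ∃ r : ℝ, 0 < r ∧ (x ∈ C a →
      Metric.closedBall (chartAt 𝔼 x x) (3 * r) ⊆ (chartAt 𝔼 x).target ∧
      (chartAt 𝔼 x).symm '' Metric.closedBall (chartAt 𝔼 x x) (3 * r) ⊆ U a) := by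
    intro a x
    by_cases hx : x ∈ C a
    swap
    · exact ⟨1, one_pos, fun h => absurd h hx⟩
    have hopen := (chartAt 𝔼 x).isOpen_inter_preimage_symm (hUo a)
    have hmem : chartAt 𝔼 x x ∈ (chartAt 𝔼 x).target ∩ (chartAt 𝔼 x).symm ⁻¹' U a :=
      ⟨mem_chart_target 𝔼 x, by
        rw [mem_preimage, (chartAt 𝔼 x).left_inv (mem_chart_source 𝔼 x)]; exact hCU a hx⟩
    obtain ⟨ε, hε, hsub⟩ := Metric.nhds_basis_closedBall.mem_iff.1 (hopen.mem_nhds hmem)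
    refine ⟨ε / 3, by positivity, fun _ => ?_⟩
    rw [mul_div_cancel₀ _ (by norm_num)]
    exact ⟨fun y hy => (hsub hy).1, by rintro _ ⟨y, hy, rfl⟩; exact (hsub hy).2⟩
  choose r hrpos hrsub using hr
  let B : M → M → Set M := fun a x =>
    (chartAt 𝔼 x).source ∩ chartAt 𝔼 x ⁻¹' Metric.ball (chartAt 𝔼 x x) (r a x)
  have hT : ∀ a, ∃ T : Finset M, (∀ x ∈ T, x ∈ C a) ∧ C a ⊆ ⋃ x ∈ T, B a x := fun a =>
    (hCcomp a).elim_nhds_subcover (B a) fun x _ =>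
      ((chartAt 𝔼 x).isOpen_inter_preimage Metric.isOpen_ball).mem_nhds
        ⟨mem_chart_source 𝔼 x, Metric.mem_ball_self (hrpos a x)⟩
  choose T hTC hT using hT
  have hcov : ∀ x, ∃ k : Σ a, T a, x ∈ (chartAt 𝔼 k.2.1).symm ''
      Metric.ball (chartAt 𝔼 k.2.1 k.2.1) (r k.1 k.2.1) := fun x => by
    obtain ⟨a, ha⟩ := iUnion_eq_univ_iff.1 hCc x
    obtain ⟨y, hy, hxy⟩ := mem_iUnion₂.1 (hT a ha)
    exact ⟨⟨a, y, hy⟩, _, hxy.2, (chartAt 𝔼 y).left_inv hxy.1⟩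
  have hlf : LocallyFinite fun k : Σ a, T a => (chartAt 𝔼 k.2.1).symm ''
      Metric.closedBall (chartAt 𝔼 k.2.1 k.2.1) (3 * r k.1 k.2.1) := fun x => by
    obtain ⟨N, hN, hfin⟩ := hUf x
    refine ⟨N, hN, (hfin.biUnion (t := fun a => range fun y : T a => (⟨a, y⟩ : Σ a, T a))
      fun a _ => finite_range _).subset ?_⟩
    rintro ⟨a, y⟩ ⟨z, hz, hzN⟩
    have ha : a ∈ {i | (U i ∩ N).Nonempty} := ⟨z, (hrsub _ _ (hTC _ _ y.2)).2 hz, hzN⟩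
    exact mem_biUnion ha ⟨y, rfl⟩
  exact ⟨{
    ι := Σ a, T a
    chart := fun k => chartAt 𝔼 k.2.1
    center := fun k => chartAt 𝔼 k.2.1 k.2.1
    radius := fun k => r k.1 k.2.1
    chart_mem := fun k => IsManifold.chart_mem_maximalAtlas _
    radius_pos := fun k => hrpos _ _
    subset_target := fun k => (hrsub _ _ (hTC _ _ k.2.2)).1
    exists_mem := hcov
    locallyFinite := hlf }⟩

namespace BallCover

variable (𝒞 : BallCover n M)

/-- The open coordinate ball of index `k`. -/
def ball (k : 𝒞.ι) : Set M := (𝒞.chart k).symm '' Metric.ball (𝒞.center k) (𝒞.radius k)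

/-- The large closed coordinate ball of index `k`. -/
def bigBall (k : 𝒞.ι) : Set M :=
  (𝒞.chart k).symm '' Metric.closedBall (𝒞.center k) (3 * 𝒞.radius k)

theorem ball_subset_bigBall (k : 𝒞.ι) : 𝒞.ball k ⊆ 𝒞.bigBall k :=
  image_mono (Metric.ball_subset_closedBall.trans
    (Metric.closedBall_subset_closedBall (by linarith [𝒞.radius_pos k])))

theorem bigBall_subset_source (k : 𝒞.ι) : 𝒞.bigBall k ⊆ (𝒞.chart k).source := by
  rintro _ ⟨y, hy, rfl⟩
  exact (𝒞.chart k).map_target (𝒞.subset_target k hy)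

theorem isCompact_bigBall (k : 𝒞.ι) : IsCompact (𝒞.bigBall k) :=
  isCompact_symm_image (isCompact_closedBall _ _) (𝒞.subset_target k)

theorem isOpen_ball (k : 𝒞.ι) : IsOpen (𝒞.ball k) :=
  (𝒞.chart k).isOpen_image_symm_of_subset_target Metric.isOpen_ball
    ((Metric.ball_subset_closedBall.trans
    (Metric.closedBall_subset_closedBall (by linarith [𝒞.radius_pos k]))).trans (𝒞.subset_target k))

theorem nonempty_ball (k : 𝒞.ι) : (𝒞.ball k).Nonempty :=
  ⟨_, mem_image_of_mem _ (Metric.mem_ball_self (𝒞.radius_pos k))⟩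

/-- The adjacency relation of the nerve of the cover by the small balls. -/
def Adj (i j : 𝒞.ι) : Prop := (𝒞.ball i ∩ 𝒞.ball j).Nonempty

theorem finite_adj (i : 𝒞.ι) : {j | 𝒞.Adj i j}.Finite := by
  refine (𝒞.locallyFinite.finite_nonempty_inter_compact (𝒞.isCompact_bigBall i)).subset ?_
  rintro j ⟨x, hi, hj⟩
  exact ⟨x, 𝒞.ball_subset_bigBall j hj, 𝒞.ball_subset_bigBall i hi⟩

/-- Otherwise the balls reachable from `i` and the remaining ones would have disjoint nonempty open
unions covering `M`. -/
theorem reflTransGen_adj [PreconnectedSpace M] (i j : 𝒞.ι) : Relation.ReflTransGen 𝒞.Adj i j := by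
  by_contra hij
  let R : Set 𝒞.ι := {k | Relation.ReflTransGen 𝒞.Adj i k}
  have h := isPreconnected_univ (α := M) (⋃ k ∈ R, 𝒞.ball k) (⋃ k ∈ Rᶜ, 𝒞.ball k)
    (isOpen_biUnion fun k _ => 𝒞.isOpen_ball k) (isOpen_biUnion fun k _ => 𝒞.isOpen_ball k)
    (fun x _ => by
      obtain ⟨k, hk⟩ := 𝒞.exists_mem x
      by_cases hkR : k ∈ R
      · exact Or.inl (mem_biUnion hkR hk)
      · exact Or.inr (mem_biUnion hkR hk))
    (by
      obtain ⟨x, hx⟩ := 𝒞.nonempty_ball i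
      exact ⟨x, trivial, mem_biUnion (Relation.ReflTransGen.refl : i ∈ R) hx⟩)
    (by
      obtain ⟨x, hx⟩ := 𝒞.nonempty_ball j
      exact ⟨x, trivial, mem_biUnion (hij : j ∈ Rᶜ) hx⟩)
  obtain ⟨x, -, hx1, hx2⟩ := h
  obtain ⟨k, hk, hxk⟩ := mem_iUnion₂.1 hx1
  obtain ⟨l, hl, hxl⟩ := mem_iUnion₂.1 hx2
  exact hl (Relation.ReflTransGen.tail hk ⟨x, hxk, hxl⟩)

theorem infinite_index [NoncompactSpace M] : Infinite 𝒞.ι := by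
  by_contra hfin
  rw [not_infinite_iff_finite] at hfin
  refine noncompact_univ M ?_
  have : (univ : Set M) = ⋃ k, 𝒞.bigBall k := (iUnion_eq_univ_iff.2 fun x =>
    (𝒞.exists_mem x).imp fun k hk => 𝒞.ball_subset_bigBall k hk).symm
  rw [this]
  exact isCompact_iUnion 𝒞.isCompact_bigBall

theorem countable_index [SigmaCompactSpace M] : Countable 𝒞.ι :=
  countable_univ_iff.1 (𝒞.locallyFinite.countable_univ fun k =>
    (𝒞.nonempty_ball k).mono (𝒞.ball_subset_bigBall k))

end BallCover

end Cover

/-! ### A radial bump that is a subsolution away from its centre -/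

section RadialBump

variable {n : ℕ}

local notation "𝔼" => EuclideanSpace ℝ (Fin n)

/-- The function `exp (-1 / (s * (R ^ 2 - ‖y - p‖ ^ 2)))` on the ball of radius `R` around `p`,
extended by zero. -/
noncomputable def radialBump (s R : ℝ) (p y : 𝔼) : ℝ :=
  expNegInvGlue (s * (R ^ 2 - ‖y - p‖ ^ 2))

theorem contDiff_radialBump (s R : ℝ) (p : 𝔼) : ContDiff ℝ ∞ (radialBump s R p) :=
  (expNegInvGlue.contDiff (n := ⊤)).comp
    (contDiff_const.mul (contDiff_const.sub ((contDiff_id.sub contDiff_const).norm_sq ℝ)))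

/-- The factor `ψ` lets one formula give both orders of derivative: `ψ = 1` for the gradient, then
`ψ` linear for the Hessian. -/
theorem partialDeriv_comp_radial {φ : ℝ → ℝ} {φ' s R : ℝ} {p y : 𝔼}
    (h : HasDerivAt φ φ' (s * (R ^ 2 - ‖y - p‖ ^ 2))) (ψ : 𝔼 → ℝ) {ψ' : 𝔼 →L[ℝ] ℝ}
    (hψ : HasFDerivAt ψ ψ' y) (i : Fin n) :
    partialDeriv i (fun z => φ (s * (R ^ 2 - ‖z - p‖ ^ 2)) * ψ z) y
      = φ' * (-2 * s * (y i - p i)) * ψ y + φ (s * (R ^ 2 - ‖y - p‖ ^ 2)) *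
        ψ' (EuclideanSpace.single i 1) := by
  have h1 : HasFDerivAt (fun z : 𝔼 => ‖z - p‖ ^ 2)
      (2 • (innerSL ℝ (y - p)).comp (ContinuousLinearMap.id ℝ 𝔼)) y :=
    ((hasFDerivAt_id y).sub_const p).norm_sq
  have h2 := ((h1.const_sub (R ^ 2)).const_mul s)
  have h3 := (h.comp_hasFDerivAt y h2).mul hψ
  unfold partialDeriv
  have h4 : fderiv ℝ (fun z => φ (s * (R ^ 2 - ‖z - p‖ ^ 2)) * ψ z) y = _ := h3.fderiv
  rw [h4]
  simp [EuclideanSpace.inner_single_right]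
  ring

theorem partialDeriv_radialBump (s R : ℝ) (p y : 𝔼) (j : Fin n) :
    partialDeriv j (radialBump s R p) y
      = ((s * (R ^ 2 - ‖y - p‖ ^ 2))⁻¹) ^ 2 * radialBump s R p y * (-2 * s * (y j - p j)) := by
  have h := expNegInvGlue.hasDerivAt_polynomial_eval_inv_mul 1 (s * (R ^ 2 - ‖y - p‖ ^ 2))
  have := partialDeriv_comp_radial (by simpa using h) (fun _ => 1) (hasFDerivAt_const 1 y) j
  have hfun : radialBump s R p = fun z => expNegInvGlue (s * (R ^ 2 - ‖z - p‖ ^ 2)) := rfl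
  rw [hfun]
  simpa using this

theorem hessian_radialBump (s R : ℝ) (p y : 𝔼) (i j : Fin n) :
    hessian (radialBump s R p) y i j = radialBump s R p y *
      (4 * s ^ 2 * (((s * (R ^ 2 - ‖y - p‖ ^ 2))⁻¹) ^ 4 - 2 * ((s * (R ^ 2 - ‖y - p‖ ^ 2))⁻¹) ^ 3)
          * ((y i - p i) * (y j - p j))
        - 2 * s * ((s * (R ^ 2 - ‖y - p‖ ^ 2))⁻¹) ^ 2 * (1 : Matrix (Fin n) (Fin n) ℝ) i j) := by
  have h := expNegInvGlue.hasDerivAt_polynomial_eval_inv_mul (Polynomial.X ^ 2)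
    (s * (R ^ 2 - ‖y - p‖ ^ 2))
  have h0 : partialDeriv j (radialBump s R p) = fun z =>
      (fun x => Polynomial.eval x⁻¹ (Polynomial.X ^ 2) * expNegInvGlue x)
        (s * (R ^ 2 - ‖z - p‖ ^ 2)) * (-2 * s * (z j - p j)) := by
    ext z
    rw [partialDeriv_radialBump]
    simp [radialBump]
  have hψ : HasFDerivAt (fun z : 𝔼 => -2 * s * (z j - p j))
      ((-2 * s) • (EuclideanSpace.proj j : 𝔼 →L[ℝ] ℝ)) y :=
    (((EuclideanSpace.proj j : 𝔼 →L[ℝ] ℝ).hasFDerivAt).sub_const (p j)).const_mul (-2 * s)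
  have h1 := partialDeriv_comp_radial h _ hψ i
  simp only [hessian, Matrix.of_apply]
  rw [h0, h1]
  by_cases hij : i = j
  · subst hij
    simp [radialBump]
    ring
  · simp [radialBump, hij, Ne.symm hij]
    ring

/-- With `q = s * (R ^ 2 - ‖y - p‖ ^ 2)` and `k = s / q ^ 2`, applying the operator multiplies the
bump by `4k²(1 - 2q)Q - 2kL + c`, where `Q` is the quadratic form of `a` at `y - p`. For small `s`
one has `q ≤ 1/4` and `k ≥ K`, and the term quadratic in `k` dominates because `Q ≥ m > 0`. -/
theorem radialBump_le_apply {a : Matrix (Fin n) (Fin n) ℝ} {b : Fin n → ℝ} {c s R m C₁ C K : ℝ}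
    {p y : 𝔼} (hs : 0 < s) (hm : 0 < m)
    (ha : m ≤ ∑ i, ∑ j, a i j * ((y i - p i) * (y j - p j)))
    (hb : ∑ i, a i i + ∑ i, b i * (y i - p i) ≤ C₁) (hc : |c| ≤ C)
    (hK : 1 ≤ K) (hK' : 2 * C₁ + C + 1 ≤ 2 * m * K) (hsR : 4 * s * R ^ 2 ≤ 1)
    (hsK : s * R ^ 4 * K ≤ 1) :
    radialBump s R p y ≤ ∑ i, ∑ j, a i j * hessian (radialBump s R p) y i j
      + ∑ i, b i * partialDeriv i (radialBump s R p) y + c * radialBump s R p y := by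
  set q := s * (R ^ 2 - ‖y - p‖ ^ 2) with hq
  set G := radialBump s R p y with hG
  have hG0 : 0 ≤ G := expNegInvGlue.nonneg _
  have hform : ∑ i, ∑ j, a i j * hessian (radialBump s R p) y i j
      + ∑ i, b i * partialDeriv i (radialBump s R p) y + c * G
      = G * (4 * s ^ 2 * (q⁻¹ ^ 4 - 2 * q⁻¹ ^ 3) *
          (∑ i, ∑ j, a i j * ((y i - p i) * (y j - p j)))
        - 2 * (s * q⁻¹ ^ 2) * (∑ i, a i i + ∑ i, b i * (y i - p i)) + c) := by
    simp only [hessian_radialBump, partialDeriv_radialBump, ← hq, ← hG]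
    have e1 : ∀ i, ∑ j, a i j * (G * (4 * s ^ 2 * (q⁻¹ ^ 4 - 2 * q⁻¹ ^ 3)
          * ((y i - p i) * (y j - p j)) - 2 * s * q⁻¹ ^ 2 * (1 : Matrix (Fin n) (Fin n) ℝ) i j))
        = G * (4 * s ^ 2 * (q⁻¹ ^ 4 - 2 * q⁻¹ ^ 3)) * ∑ j, a i j * ((y i - p i) * (y j - p j))
          - G * (2 * s * q⁻¹ ^ 2) * a i i := fun i => by
      have : a i i = ∑ j, a i j * (1 : Matrix (Fin n) (Fin n) ℝ) i j := by
        simp [Matrix.one_apply]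
      rw [this, Finset.mul_sum, Finset.mul_sum, ← Finset.sum_sub_distrib]
      exact Finset.sum_congr rfl fun j _ => by ring
    have e2 : ∑ i, b i * (q⁻¹ ^ 2 * G * (-2 * s * (y i - p i)))
        = - (G * (2 * s * q⁻¹ ^ 2)) * ∑ i, b i * (y i - p i) := by
      rw [Finset.mul_sum]
      exact Finset.sum_congr rfl fun j _ => by ring
    simp only [e1, e2, Finset.sum_sub_distrib, ← Finset.mul_sum]
    ring
  rw [hform]
  -- Outside the ball of radius `R` both sides vanish.
  rcases le_or_gt q 0 with hq0 | hq0
  · have : G = 0 := expNegInvGlue.zero_of_nonpos hq0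
    simp [this]
  have hqR : q ≤ s * R ^ 2 := by
    rw [hq]; gcongr; linarith [sq_nonneg ‖y - p‖]
  set k := s * q⁻¹ ^ 2 with hk
  have hkK : K ≤ k := by
    have h1 : q ^ 2 ≤ (s * R ^ 2) ^ 2 := by gcongr
    have h2 : K * q ^ 2 ≤ s := by
      calc K * q ^ 2 ≤ K * (s * R ^ 2) ^ 2 := by gcongr
        _ = s * (s * R ^ 4 * K) := by ring
        _ ≤ s * 1 := by gcongr
        _ = s := mul_one s
    rw [hk, inv_pow, ← div_eq_mul_inv, le_div_iff₀ (by positivity)]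
    exact h2
  have hk2 : 4 * s ^ 2 * (q⁻¹ ^ 4 - 2 * q⁻¹ ^ 3) = 4 * k ^ 2 * (1 - 2 * q) := by
    rw [hk]; field_simp
  rw [hk2]
  set Q := ∑ i, ∑ j, a i j * ((y i - p i) * (y j - p j))
  set L := ∑ i, a i i + ∑ i, b i * (y i - p i)
  have hk0 : 0 < k := by linarith
  have h1 : 2 * k ^ 2 * m ≤ 4 * k ^ 2 * (1 - 2 * q) * Q := by
    have : (1 : ℝ) / 2 ≤ 1 - 2 * q := by linarith
    calc 2 * k ^ 2 * m = 4 * k ^ 2 * (1 / 2) * m := by ring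
      _ ≤ 4 * k ^ 2 * (1 - 2 * q) * Q := by gcongr
  have h2 : 2 * k * L ≤ 2 * k * C₁ := by gcongr
  have h3 : k * (2 * C₁ + C + 1) ≤ 2 * k ^ 2 * m := by
    calc k * (2 * C₁ + C + 1) ≤ k * (2 * m * K) := by gcongr
      _ ≤ k * (2 * m * k) := by gcongr
      _ = _ := by ring
  have hC0 : 0 ≤ C := (abs_nonneg c).trans hc
  have h4 : C + 1 ≤ k * (C + 1) := le_mul_of_one_le_left (by linarith) (hK.trans hkK)
  have h5 : -C ≤ c := (abs_le.1 hc).1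
  refine le_mul_of_one_le_right hG0 ?_
  linarith

end RadialBump

/-! ### Bumps adapted to the balls of the cover -/

section Pushing

variable {n : ℕ} {M : Type*} [TopologicalSpace M] [ChartedSpace (EuclideanSpace ℝ (Fin n)) M]

local notation "𝔼" => EuclideanSpace ℝ (Fin n)

/-- On each coordinate ball of the cover there is a compactly supported nonnegative function which
is a strict subsolution on its support, except in a given open set meeting the ball. -/
theorem BallCover.exists_pushing [IsManifold (𝓡 n) ∞ M] [T2Space M] (𝒞 : BallCover n M)
    {A : (M → ℝ) → M → ℝ} (hA : IsLocallyUniformlyElliptic n A) (k : 𝒞.ι) {O : Set M}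
    (hO : IsOpen O) (hne : (𝒞.ball k ∩ O).Nonempty) :
    ∃ α : M → ℝ, ContMDiff (𝓡 n) 𝓘(ℝ, ℝ) ∞ α ∧ (∀ x, 0 ≤ α x) ∧ (∀ x ∉ 𝒞.bigBall k, α x = 0) ∧
      (∃ m : ℝ, 0 < m ∧ ∀ x ∈ 𝒞.ball k, m ≤ α x) ∧ ∀ x ∉ O, α x ≤ A α x := by
  obtain ⟨_, ⟨p, hp, rfl⟩, hpO⟩ := hne
  have he := 𝒞.chart_mem k
  have hr := 𝒞.radius_pos k
  have hKt := 𝒞.subset_target k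
  have hWs := 𝒞.bigBall_subset_source k
  have hWc := 𝒞.isCompact_bigBall k
  set e := 𝒞.chart k with he'
  set r := 𝒞.radius k with hr'
  obtain ⟨a, b, c, ha, hb, hc, hsymm, hell, hform⟩ := hA e he
  have hpc : p ∈ Metric.closedBall (𝒞.center k) (3 * r) :=
    Metric.closedBall_subset_closedBall (by linarith) (Metric.ball_subset_closedBall hp)
  have hcoord : ∀ i, LocallyBoundedOn (fun x => (e x) i - p i) e.source := fun i =>
    .of_continuousAt fun x hx =>
      ((EuclideanSpace.proj i : 𝔼 →L[ℝ] ℝ).continuous.continuousAt.comp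
        (e.continuousAt hx)).sub continuousAt_const
  obtain ⟨C₁, -, hC₁⟩ := ((LocallyBoundedOn.sum Finset.univ fun i _ => ha i i).add
    (.sum Finset.univ fun i _ => (hb i).mul (hcoord i))).exists_bound hWc hWs
  obtain ⟨C, hC0, hC⟩ := hc.exists_bound hWc hWs
  obtain ⟨δ, hδ, hδa⟩ := hell.exists_bound hWc hWs
  obtain ⟨η, hη, hηO⟩ := Metric.nhds_basis_ball.mem_iff.1
    ((e.isOpen_inter_preimage_symm hO).mem_nhds ⟨hKt hpc, hpO⟩)
  -- Ellipticity bounds the quadratic form at `e x - p` below by `δ * ‖e x - p‖ ^ 2`, which is at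
  -- least `m` outside `O` because the `η`-ball around `p` lies in `O`.
  set m := δ * η ^ 2 with hm
  have hm0 : 0 < m := by positivity
  -- As `p` is at distance less than `r` from the centre, the ball of radius `2 * r` around `p`
  -- contains the small closed ball and lies in the one of radius `3 * r`.
  set R := 2 * r
  have hR : 0 < R := by positivity
  set K := max 1 ((2 * C₁ + C + 1) / (2 * m)) with hK
  have hK1 : 1 ≤ K := le_max_left _ _
  have hK2 : 2 * C₁ + C + 1 ≤ 2 * m * K := by
    have : (2 * C₁ + C + 1) / (2 * m) ≤ K := le_max_right _ _
    rw [div_le_iff₀ (by positivity)] at this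
    linarith
  have hK0 : 0 < K := by linarith
  set s := min (1 / (4 * R ^ 2)) (1 / (R ^ 4 * K)) with hs
  have hs0 : 0 < s := lt_min (by positivity) (by positivity)
  have hs1 : 4 * s * R ^ 2 ≤ 1 := by
    have : s ≤ 1 / (4 * R ^ 2) := min_le_left _ _
    rw [le_div_iff₀ (by positivity)] at this
    linarith
  have hs2 : s * R ^ 4 * K ≤ 1 := by
    have : s ≤ 1 / (R ^ 4 * K) := min_le_right _ _
    rw [le_div_iff₀ (by positivity)] at this
    linarith
  have hzero : ∀ y ∉ Metric.closedBall (𝒞.center k) (3 * r), radialBump s R p y = 0 := by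
    intro y hy
    refine expNegInvGlue.zero_of_nonpos (mul_nonpos_of_nonneg_of_nonpos hs0.le ?_)
    rw [Metric.mem_closedBall, not_le] at hy
    rw [Metric.mem_ball] at hp
    have h1 : R ≤ ‖y - p‖ := by
      rw [← dist_eq_norm]
      linarith [dist_triangle y p (𝒞.center k)]
    have : R ^ 2 ≤ ‖y - p‖ ^ 2 := by gcongr
    linarith
  have hsm := contMDiff_extend he (contDiff_radialBump s R p) (isCompact_closedBall _ _) hKt hzero
  refine ⟨extend e (radialBump s R p), hsm, fun x => ?_,
    fun x hx => extend_eq_zero hzero hx, ?_, fun x hx => ?_⟩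
  · exact indicator_nonneg (f := radialBump s R p ∘ e) (fun _ _ => expNegInvGlue.nonneg _) x
  · have hpos : ∀ y ∈ Metric.closedBall (𝒞.center k) r, 0 < radialBump s R p y := fun y hy => by
      refine expNegInvGlue.pos_of_pos (mul_pos hs0 ?_)
      rw [Metric.mem_closedBall] at hy
      rw [Metric.mem_ball'] at hp
      have h1 : ‖y - p‖ < R := by
        rw [← dist_eq_norm]
        linarith [dist_triangle y (𝒞.center k) p]
      have : ‖y - p‖ ^ 2 < R ^ 2 := by gcongr
      linarith
    obtain ⟨m', hm', hle⟩ := (isCompact_closedBall (𝒞.center k) r).exists_forall_le'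
      (contDiff_radialBump s R p).continuous.continuousOn hpos
    refine ⟨m', hm', ?_⟩
    rintro _ ⟨y, hy, rfl⟩
    have hyt : y ∈ e.target := hKt (Metric.closedBall_subset_closedBall (by linarith)
      (Metric.ball_subset_closedBall hy))
    rw [extend_of_mem _ (e.map_target hyt), e.right_inv hyt]
    exact hle y (Metric.ball_subset_closedBall hy)
  · by_cases hxW : x ∈ 𝒞.bigBall k
    swap
    · rw [hA.apply_eq_zero hsm hWc.isClosed (fun z hz => extend_eq_zero hzero hz) hxW,
        extend_eq_zero hzero hxW]
    have hxs := hWs hxW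
    rw [hform _ (hsm.of_le two_le_infty) x hxs]
    have hev := extend_comp_symm e (radialBump s R p) (e.map_source hxs)
    rw [hessian_congr hev, extend_of_mem _ hxs]
    simp only [fun i => (partialDeriv_congr hev i).self_of_nhds]
    refine radialBump_le_apply hs0 hm0 ?_ ((le_abs_self _).trans (hC₁ x hxW)) (hC x hxW)
      hK1 hK2 hs1 hs2
    refine le_trans ?_ (le_sum_of_le_eigenvalues (hsymm x hxs) (hδa x hxW) fun i => (e x) i - p i)
    have h1 : ∑ i, ((e x) i - p i) ^ 2 = ‖e x - p‖ ^ 2 := by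
      rw [EuclideanSpace.real_norm_sq_eq]
      simp
    rw [h1, hm]
    gcongr
    by_contra! hlt
    refine hx ?_
    have := (hηO (by rwa [Metric.mem_ball, dist_eq_norm] : e x ∈ Metric.ball p η)).2
    rwa [mem_preimage, e.left_inv hxs] at this

end Pushing

/-! ### Strict subsolutions from recursively chosen coefficients -/

section Subsolution

variable {n : ℕ} {M : Type*} [TopologicalSpace M] [ChartedSpace (EuclideanSpace ℝ (Fin n)) M]

local notation "𝔼" => EuclideanSpace ℝ (Fin n)

/-- The set `J` depends only on `x` and `W`, so several families can be summed over the same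
indices. -/
theorem eventually_finsum_eq_sum {ι : Type*} {W : ι → Set M} (hW : LocallyFinite W)
    (x : M) : ∃ J : Finset ι, (∀ i, x ∈ W i → i ∈ J) ∧
      ∀ (f : ι → M → ℝ) (_ : ∀ i, ∀ x ∉ W i, f i x = 0) (t : ι → ℝ), (fun z => ∑ᶠ i, t i * f i z) =ᶠ[𝓝 x] fun z => ∑ i ∈ J, t i * f i z := by
  obtain ⟨N, hN, hfin⟩ := hW x
  refine ⟨hfin.toFinset, fun i hi => hfin.mem_toFinset.2 ⟨x, hi, mem_of_mem_nhds hN⟩, fun f hf t => ?_⟩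
  filter_upwards [hN] with z hz
  refine finsum_eq_sum_of_support_subset _ fun i hi => ?_
  by_contra hiJ
  refine hi ?_
  have : z ∉ W i := fun h => hiJ (by simpa using ⟨z, h, hz⟩)
  simp [hf i z this]

theorem contMDiff_finsum_mul {ι : Type*} {W : ι → Set M} (hW : LocallyFinite W)
    {f : ι → M → ℝ} (hf : ∀ i, ∀ x ∉ W i, f i x = 0)
    (hs : ∀ i, ContMDiff (𝓡 n) 𝓘(ℝ, ℝ) ∞ (f i)) (t : ι → ℝ) :
    ContMDiff (𝓡 n) 𝓘(ℝ, ℝ) ∞ fun z => ∑ᶠ i, t i * f i z := by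
  refine contMDiff_finsum (fun i => contMDiff_const.mul (hs i)) (hW.subset fun i x hx => ?_)
  by_contra h
  exact hx (by simp [hf i x h])

/-- Coefficients along a well-founded relation which dominate those of finitely many
predecessors. -/
theorem exists_dominating {V : Type*} {S : V → V → Prop} (hS : WellFounded S)
    (hfin : ∀ i, {j | S j i}.Finite) {b d m : V → ℝ} (hb : ∀ i, 0 ≤ b i) (hd : ∀ i, 0 ≤ d i)
    (hm : ∀ i, 0 < m i) :
    ∃ C : V → ℝ, ∀ i, 0 ≤ C i ∧ b i + ∑ j ∈ (hfin i).toFinset, C j * d j ≤ C i * m i := by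
  classical
  let C : V → ℝ := hS.fix fun i rec =>
    (b i + ∑ j ∈ (hfin i).toFinset.attach, rec j.1 ((hfin i).mem_toFinset.1 j.2) * d j.1) / m i
  have hC : ∀ i, C i = (b i + ∑ j ∈ (hfin i).toFinset, C j * d j) / m i := fun i => by
    simp only [C]
    rw [hS.fix_eq]
    congr 2
    exact Finset.sum_attach _ fun j => C j * d j
  have hpos : ∀ i, 0 ≤ C i := fun i => by
    induction i using hS.induction with
    | _ i ih =>
      rw [hC]
      refine div_nonneg (add_nonneg (hb i) (Finset.sum_nonneg fun j hj => ?_)) (hm i).le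
      exact mul_nonneg (ih j ((hfin i).mem_toFinset.1 hj)) (hd j)
  refine ⟨C, fun i => ⟨hpos i, ?_⟩⟩
  conv_rhs => rw [hC]
  rw [div_mul_cancel₀ _ (hm i).ne']

/-- On a connected noncompact manifold there are arbitrarily strict and arbitrarily large
subsolutions of an elliptic operator. -/
theorem BallCover.exists_subsolution [IsManifold (𝓡 n) ∞ M] [T2Space M]
    [SecondCountableTopology M] [ConnectedSpace M] [NoncompactSpace M] (𝒞 : BallCover n M)
    {A : (M → ℝ) → M → ℝ} (hA : IsLocallyUniformlyElliptic n A) {S : M → ℝ}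
    (hS : LocallyBoundedOn S univ) :
    ∃ ψ : M → ℝ, ContMDiff (𝓡 n) 𝓘(ℝ, ℝ) ∞ ψ ∧ (∀ x, S x < ψ x) ∧ ∀ x, S x < A ψ x := by
  have : LocallyCompactSpace M := ChartedSpace.locallyCompactSpace 𝔼 M
  have := 𝒞.infinite_index
  have := 𝒞.countable_index
  obtain ⟨φ, hφ, hwf⟩ := exists_potential (Adj := 𝒞.Adj) (fun i j h => by
    rwa [BallCover.Adj, inter_comm]) 𝒞.finite_adj 𝒞.reflTransGen_adj
  choose nxt hadj hlt using hφ
  -- The bad set of `α k` is put in the overlap with a ball of smaller potential.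
  choose α hsm h0 hzero hlow hsub using fun k => 𝒞.exists_pushing hA k
    ((𝒞.isOpen_ball k).inter (𝒞.isOpen_ball (nxt k))) (by
      have := hadj k
      rwa [BallCover.Adj, ← inter_self (𝒞.ball k), inter_assoc] at this)
  choose m hm hlow using hlow
  choose d hd0 hd using fun k => (hA.locallyBoundedOn_apply (hsm k)).exists_bound
    (𝒞.isCompact_bigBall k) (subset_univ _)
  choose b hb0 hb using fun k => hS.exists_bound (𝒞.isCompact_bigBall k) (subset_univ _)
  have hfin : ∀ i, {j | 𝒞.Adj j i ∧ φ i < φ j}.Finite := fun i =>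
    (𝒞.finite_adj i).subset fun j hj => by
      have := hj.1
      rwa [BallCover.Adj, inter_comm] at this
  -- The added 1 makes the final inequalities strict.
  obtain ⟨C, hC⟩ := exists_dominating hwf hfin (b := fun i => b i + 1)
    (fun i => by linarith [hb0 i]) hd0 hm
  have hψ := contMDiff_finsum_mul 𝒞.locallyFinite hzero hsm C
  refine ⟨_, hψ, ?_⟩
  rw [← forall_and]
  intro x
  obtain ⟨J, hJ, hsum⟩ := eventually_finsum_eq_sum 𝒞.locallyFinite x
  replace hsum := hsum α hzero
  rw [hA.apply_eq_sum J C (fun j _ => hsm j) hψ (hsum C)]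
  rw [show ∑ᶠ i, C i * α i x = ∑ i ∈ J, C i * α i x from (hsum C).self_of_nhds]
  classical
  obtain ⟨i, hi, hmin⟩ : ∃ i, x ∈ 𝒞.ball i ∧ ∀ j, x ∈ 𝒞.ball j → φ i ≤ φ j := by
    obtain ⟨k, hk⟩ := 𝒞.exists_mem x
    have hne : (J.filter fun j => x ∈ 𝒞.ball j).Nonempty :=
      ⟨k, Finset.mem_filter.2 ⟨hJ k (𝒞.ball_subset_bigBall k hk), hk⟩⟩
    obtain ⟨i, hi, hmin⟩ := Finset.exists_min_image _ φ hne
    exact ⟨i, (Finset.mem_filter.1 hi).2, fun j hj =>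
      hmin j (Finset.mem_filter.2 ⟨hJ j (𝒞.ball_subset_bigBall j hj), hj⟩)⟩
  have hiJ := hJ i (𝒞.ball_subset_bigBall i hi)
  have hiO : x ∉ 𝒞.ball i ∩ 𝒞.ball (nxt i) := fun h => not_lt.2 (hmin _ h.2) (hlt i)
  have hCd : 0 ≤ ∑ j ∈ (hfin i).toFinset, C j * d j :=
    Finset.sum_nonneg fun j _ => mul_nonneg (hC j).1 (hd0 j)
  have hCα : C i * m i ≤ C i * α i x := mul_le_mul_of_nonneg_left (hlow i x hi) (hC i).1
  have hCA : C i * m i ≤ C i * A (α i) x :=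
    hCα.trans (mul_le_mul_of_nonneg_left (hsub i x hiO) (hC i).1)
  have hSb : S x ≤ b i := (le_abs_self _).trans (hb i x (𝒞.ball_subset_bigBall i hi))
  have hCi := (hC i).2
  constructor
  · have : C i * α i x ≤ ∑ j ∈ J, C j * α j x :=
      Finset.single_le_sum (f := fun j => C j * α j x)
        (fun j _ => mul_nonneg (hC j).1 (h0 j x)) hiJ
    linarith
  · rw [← Finset.add_sum_erase J _ hiJ]
    -- If `x` is in the bad set of `j`, then `x` lies in the ball of `nxt j`, so `φ i ≤ φ (nxt j) <
    -- φ j` and `C i` already accounts for `j`. All other terms are nonnegative.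
    have hterm : ∀ j ∈ J.erase i, -(if j ∈ (hfin i).toFinset then C j * d j else 0)
        ≤ C j * A (α j) x := by
      intro j hj
      by_cases hjO : x ∈ 𝒞.ball j ∩ 𝒞.ball (nxt j)
      · have hji : j ∈ (hfin i).toFinset := (hfin i).mem_toFinset.2
          ⟨⟨x, hjO.1, hi⟩, (hmin _ hjO.2).trans_lt (hlt j)⟩
        rw [if_pos hji, ← mul_neg]
        exact mul_le_mul_of_nonneg_left
          (abs_le.1 (hd j x (𝒞.ball_subset_bigBall j hjO.1))).1 (hC j).1
      · have h1 : 0 ≤ C j * A (α j) x :=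
          mul_nonneg (hC j).1 ((h0 j x).trans (hsub j x hjO))
        refine le_trans ?_ h1
        split_ifs
        · exact neg_nonpos.2 (mul_nonneg (hC j).1 (hd0 j))
        · simp
    have h1 := Finset.sum_le_sum hterm
    rw [Finset.sum_neg_distrib, ← Finset.sum_filter] at h1
    have h2 : ∑ j ∈ (J.erase i).filter (· ∈ (hfin i).toFinset), C j * d j
        ≤ ∑ j ∈ (hfin i).toFinset, C j * d j :=
      Finset.sum_le_sum_of_subset_of_nonneg (fun j hj => (Finset.mem_filter.1 hj).2)
        fun j _ _ => mul_nonneg (hC j).1 (hd0 j)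
    linarith

end Subsolution

/-! ### Nondegeneracy as an open and generic condition -/

section AddSum

variable {n : ℕ}

local notation "𝔼" => EuclideanSpace ℝ (Fin n)

/-- The unperturbed function is treated as one more summand, indexed by `none` with coefficient 1.
-/
theorem partialDeriv_add_sum {ι : Type*} (J : Finset ι) (t : ι → ℝ) {f₀ : 𝔼 → ℝ} {f : ι → 𝔼 → ℝ}
    {y : 𝔼} (hf₀ : DifferentiableAt ℝ f₀ y) (hf : ∀ j ∈ J, DifferentiableAt ℝ (f j) y)
    (i : Fin n) : partialDeriv i (fun z => f₀ z + ∑ j ∈ J, t j * f j z) y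
      = partialDeriv i f₀ y + ∑ j ∈ J, t j * partialDeriv i (f j) y := by
  have h := partialDeriv_sum (Finset.insertNone J) (fun o => o.elim 1 t)
    (f := fun o => o.elim f₀ f) (y := y)
    (by rintro (_ | j) hj; exacts [hf₀, hf j (by simpa using hj)]) i
  simpa [Finset.sum_insertNone] using h

theorem hessian_add_sum {ι : Type*} (J : Finset ι) (t : ι → ℝ) {f₀ : 𝔼 → ℝ} {f : ι → 𝔼 → ℝ}
    {y : 𝔼} (hf₀ : ContDiffAt ℝ 2 f₀ y) (hf : ∀ j ∈ J, ContDiffAt ℝ 2 (f j) y)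
    (a b : Fin n) : hessian (fun z => f₀ z + ∑ j ∈ J, t j * f j z) y a b
      = hessian f₀ y a b + ∑ j ∈ J, t j * hessian (f j) y a b := by
  have h := hessian_sum (Finset.insertNone J) (fun o => o.elim 1 t)
    (f := fun o => o.elim f₀ f) (y := y)
    (by rintro (_ | j) hj; exacts [hf₀, hf j (by simpa using hj)]) a b
  simpa [Finset.sum_insertNone] using h

theorem partialDeriv_coord (i l : Fin n) :
    partialDeriv i (fun z : 𝔼 => z l) = fun _ => (1 : Matrix (Fin n) (Fin n) ℝ) l i := by
  ext y
  have h : HasFDerivAt (fun z : 𝔼 => z l) (EuclideanSpace.proj l : 𝔼 →L[ℝ] ℝ) y :=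
    (EuclideanSpace.proj l : 𝔼 →L[ℝ] ℝ).hasFDerivAt
  simp [partialDeriv, h.fderiv, Matrix.one_apply]

theorem hessian_coord (l : Fin n) (y : 𝔼) : hessian (fun z : 𝔼 => z l) y = 0 := by
  ext i j
  simp [hessian, partialDeriv_coord, partialDeriv]

theorem contDiff_coord (l : Fin n) : ContDiff ℝ ∞ fun z : 𝔼 => z l :=
  (EuclideanSpace.proj l : 𝔼 →L[ℝ] ℝ).contDiff

/-- All critical points of `g` in `K` are nondegenerate. -/
def NondegenerateOn (g : 𝔼 → ℝ) (K : Set 𝔼) : Prop :=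
  ∀ y ∈ K, (∀ i, partialDeriv i g y = 0) → (hessian g y).det ≠ 0

/-- The bad parameters are the projection, along the compact set `K`, of the closed set of pairs of
a degenerate critical point and a parameter. -/
theorem isOpen_setOf_nondegenerateOn {ι P : Type*} [TopologicalSpace P] (J : Finset ι)
    {t : P → ι → ℝ} (ht : ∀ j, Continuous fun p => t p j) {f₀ : 𝔼 → ℝ} {f : ι → 𝔼 → ℝ}
    {K : Set 𝔼} (hK : IsCompact K) (hf₀ : ∀ y ∈ K, ContDiffAt ℝ ∞ f₀ y)
    (hf : ∀ j, ∀ y ∈ K, ContDiffAt ℝ ∞ (f j) y) :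
    IsOpen {p | NondegenerateOn (fun z => f₀ z + ∑ j ∈ J, t p j * f j z) K} := by
  have : CompactSpace K := isCompact_iff_compactSpace.1 hK
  let Z : Set (K × P) := 
    (⋂ i, {q | partialDeriv i (fun z => f₀ z + ∑ j ∈ J, t q.2 j * f j z) q.1 = 0}) ∩
      {q | (hessian (fun z => f₀ z + ∑ j ∈ J, t q.2 j * f j z) q.1).det = 0}
  have hrestr : ∀ g : 𝔼 → ℝ, (∀ y ∈ K, ContDiffAt ℝ ∞ g y) → Continuous fun q : K × P => g q.1 :=
    fun g hg => by
      have h1 : Continuous fun y : K => g y := continuous_iff_continuousAt.2 fun y =>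
        (hg y y.2).continuousAt.comp continuous_subtype_val.continuousAt
      exact h1.comp continuous_fst
  have hpd : ∀ g : 𝔼 → ℝ, (∀ y ∈ K, ContDiffAt ℝ ∞ g y) → ∀ i,
      ∀ y ∈ K, ContDiffAt ℝ ∞ (partialDeriv i g) y := fun g hg i y hy =>
    ContDiffAt.partialDeriv (hg y hy) (by simp) i
  have hZ : IsClosed Z := by
    refine IsClosed.inter ?_ ?_
    · refine isClosed_iInter fun i => isClosed_eq ?_ continuous_const
      have : (fun q : K × P => partialDeriv i (fun z => f₀ z + ∑ j ∈ J, t q.2 j * f j z) q.1)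
          = fun q => partialDeriv i f₀ q.1 + ∑ j ∈ J, t q.2 j * partialDeriv i (f j) q.1 := by
        ext q
        exact partialDeriv_add_sum J _ ((hf₀ q.1 q.1.2).differentiableAt (by simp))
          (fun j _ => (hf j q.1 q.1.2).differentiableAt (by simp)) i
      rw [this]
      exact (hrestr _ (hpd _ hf₀ i)).add (continuous_finsetSum _ fun j _ =>
        ((ht j).comp continuous_snd).mul (hrestr _ (hpd _ (hf j) i)))
    · refine isClosed_eq (Continuous.matrix_det (continuous_matrix fun a b => ?_)) continuous_const
      have : (fun q : K × P => hessian (fun z => f₀ z + ∑ j ∈ J, t q.2 j * f j z) q.1 a b)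
          = fun q => hessian f₀ q.1 a b + ∑ j ∈ J, t q.2 j * hessian (f j) q.1 a b := by
        ext q
        exact hessian_add_sum J _ ((hf₀ q.1 q.1.2).of_le two_le_infty)
          (fun j _ => (hf j q.1 q.1.2).of_le two_le_infty) a b
      rw [this]
      exact (hrestr _ (hpd _ (hpd _ hf₀ b) a)).add (continuous_finsetSum _ fun j _ =>
        ((ht j).comp continuous_snd).mul (hrestr _ (hpd _ (hpd _ (hf j) b) a)))
  have hcl := isClosedMap_snd_of_compactSpace Z hZ
  convert hcl.isOpen_compl using 1
  ext p
  constructor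
  · rintro h ⟨⟨y, q⟩, ⟨h1, h2⟩, rfl⟩
    have h3 := mem_iInter.1 h1
    exact h y y.2 (fun i => h3 i) h2
  · exact fun h y hy h1 h2 => h ⟨(⟨y, hy⟩, p), ⟨mem_iInter.2 h1, h2⟩, rfl⟩

theorem nondegenerateOn_of_linear_perturbation {f g : 𝔼 → ℝ} {U : Set 𝔼} (hU : IsOpen U)
    (hf : ∀ y ∈ U, ContDiffAt ℝ ∞ f y) {τ : 𝔼}
    (hτ : ∀ y ∈ U, (∀ i, partialDeriv i f y + τ i = 0) → (hessian f y).det ≠ 0)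
    (hg : ∀ y ∈ U, g y = f y + ∑ l, τ l * y l) : NondegenerateOn g U := by
  intro y hy hcrit
  have hev : g =ᶠ[𝓝 y] fun z => f z + ∑ l, τ l * z l := by
    filter_upwards [hU.mem_nhds hy] with z hz using hg z hz
  have h1 : hessian g y = hessian f y := by
    rw [hessian_congr hev]
    ext a b
    rw [hessian_add_sum Finset.univ τ (f := fun l z => z l) ((hf y hy).of_le two_le_infty)
      fun l _ => (contDiff_coord l).contDiffAt.of_le two_le_infty]
    simp [hessian_coord]
  rw [h1]
  refine hτ y hy fun i => ?_
  rw [← hcrit i, (partialDeriv_congr hev i).self_of_nhds,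
    partialDeriv_add_sum Finset.univ τ (f := fun l z => z l)
      ((hf y hy).differentiableAt (by simp))
      fun l _ => (contDiff_coord l).contDiffAt.differentiableAt (by simp)]
  simp [partialDeriv_coord, Matrix.one_apply]

/-- A set of full measure meets every open set around a point of the unit cube in a point of the
cube. -/
theorem exists_mem_cube_of_ae {p : 𝔼 → Prop} (hp : ∀ᵐ τ : 𝔼, p τ) {U : Set 𝔼} (hU : IsOpen U)
    {τ₀ : 𝔼} (hτ₀ : τ₀ ∈ U) (hcube : ∀ l, |τ₀ l| ≤ 1) :
    ∃ τ ∈ U, p τ ∧ ∀ l, |τ l| ≤ 1 := by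
  let Q : Set 𝔼 := {τ | ∀ l, |τ l| < 1}
  have hQ : IsOpen Q := by
    simp only [Q, ofPred_forall]
    exact isOpen_iInter_of_finite fun l =>
      isOpen_lt ((contDiff_coord l).continuous.abs) continuous_const
  -- `τ₀` may lie on the boundary of the cube; shrinking it slightly towards the origin moves it
  -- inside without leaving `U`.
  have hne : (U ∩ Q).Nonempty := by
    have hc : ContinuousAt (fun ε : ℝ => (1 - ε) • τ₀) 0 := by fun_prop
    have h1 : ∀ᶠ ε : ℝ in 𝓝[>] 0, (1 - ε) • τ₀ ∈ U :=
      (hc.tendsto.mono_left nhdsWithin_le_nhds).eventually (by simpa using hU.mem_nhds hτ₀)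
    have h2 : ∀ᶠ ε : ℝ in 𝓝[>] 0, ε ∈ Ioo (0 : ℝ) 1 := Ioo_mem_nhdsGT one_pos
    obtain ⟨ε, h1, h2, h3⟩ := (h1.and h2).exists
    refine ⟨_, h1, fun l => ?_⟩
    have : |((1 - ε) • τ₀) l| = (1 - ε) * |τ₀ l| := by
      simp [abs_mul, abs_of_pos (sub_pos.2 h3)]
    rw [this]
    nlinarith [hcube l]
  obtain ⟨τ, hτ, hτp⟩ := (MeasureTheory.Measure.dense_of_ae hp).inter_open_nonempty _
    (hU.inter hQ) hne
  exact ⟨τ, hτ.1, hτp, fun l => (hτ.2 l).le⟩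

end AddSum

/-! ### Perturbation to a Morse function -/

section Morse

universe u

variable {n : ℕ} {M : Type u} [TopologicalSpace M] [ChartedSpace (EuclideanSpace ℝ (Fin n)) M]

local notation "𝔼" => EuclideanSpace ℝ (Fin n)

theorem contDiffAt_transition [IsManifold (𝓡 n) ∞ M] {e e' : OpenPartialHomeomorph M 𝔼}
    (he : e ∈ IsManifold.maximalAtlas (𝓡 n) ∞ M) (he' : e' ∈ IsManifold.maximalAtlas (𝓡 n) ∞ M)
    {y : 𝔼} (hy : y ∈ e.target) (hy' : e.symm y ∈ e'.source) :
    ContDiffAt ℝ ∞ (fun z => e' (e.symm z)) y := by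
  have h1 : ContMDiffAt (𝓡 n) (𝓡 n) ∞ e.symm y :=
    (contMDiffOn_symm_of_mem_maximalAtlas he).contMDiffAt (e.open_target.mem_nhds hy)
  have h2 : ContMDiffAt (𝓡 n) (𝓡 n) ∞ e' (e.symm y) :=
    (contMDiffOn_of_mem_maximalAtlas he').contMDiffAt (e'.open_source.mem_nhds hy')
  exact contMDiffAt_iff_contDiffAt.1 (h2.comp y h1)

theorem fderiv_comp_symm_eq_zero [IsManifold (𝓡 n) ∞ M] {e : OpenPartialHomeomorph M 𝔼}
    (he : e ∈ IsManifold.maximalAtlas (𝓡 n) ∞ M) {u : M → ℝ}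
    (hu : ContMDiff (𝓡 n) 𝓘(ℝ, ℝ) ∞ u) {x : M} (hx : x ∈ e.source)
    (hcrit : mfderiv (𝓡 n) 𝓘(ℝ, ℝ) u x = 0) : fderiv ℝ (u ∘ e.symm) (e x) = 0 := by
  have h1 : MDifferentiableAt (𝓡 n) (𝓡 n) e.symm (e x) :=
    ((contMDiffOn_symm_of_mem_maximalAtlas he).contMDiffAt
      (e.open_target.mem_nhds (e.map_source hx))).mdifferentiableAt (by simp)
  have h2 : HasMFDerivAt (𝓡 n) 𝓘(ℝ, ℝ) u (e.symm (e x)) 0 := by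
    rw [e.left_inv hx, ← hcrit]
    exact (hu.mdifferentiable (by simp) x).hasMFDerivAt
  have h3 := h2.comp (e x) h1.hasMFDerivAt
  rw [ContinuousLinearMap.zero_comp] at h3
  have h4 : HasFDerivAt (u ∘ e.symm) (0 : 𝔼 →L[ℝ] ℝ) (e x) := hasMFDerivAt_iff_hasFDerivAt.1 h3
  exact h4.fderiv

/-- Hence nondegeneracy needs to be checked only in one chart around each critical point, here a
chart of the cover. -/
theorem det_hessian_chart_ne_zero [IsManifold (𝓡 n) ∞ M] {e e' : OpenPartialHomeomorph M 𝔼}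
    (he : e ∈ IsManifold.maximalAtlas (𝓡 n) ∞ M) (he' : e' ∈ IsManifold.maximalAtlas (𝓡 n) ∞ M)
    {u : M → ℝ} (hu : ContMDiff (𝓡 n) 𝓘(ℝ, ℝ) ∞ u) {x : M} (hx : x ∈ e.source)
    (hx' : x ∈ e'.source) (hcrit : mfderiv (𝓡 n) 𝓘(ℝ, ℝ) u x = 0)
    (hdet : (hessian (u ∘ e'.symm) (e' x)).det ≠ 0) : (hessian (u ∘ e.symm) (e x)).det ≠ 0 := by
  have hxt := e.map_source hx
  have hxt' := e'.map_source hx'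
  have hτx : e' (e.symm (e x)) = e' x := by rw [e.left_inv hx]
  have hU : ∀ᶠ z in 𝓝 (e x), z ∈ e.target ∧ e.symm z ∈ e'.source :=
    (e.isOpen_inter_preimage_symm e'.open_source).mem_nhds
      ⟨hxt, by rwa [mem_preimage, e.left_inv hx]⟩
  have h := det_hessian_comp_ne_zero (g := u ∘ e'.symm) (τ := fun z => e' (e.symm z))
    (σ := fun z => e (e'.symm z)) (y := e x)
    (by rw [hτx]; exact (contDiffAt_comp_symm (k := ⊤) he' hu hxt').of_le two_le_infty)
    ((contDiffAt_transition he he' hxt (by rwa [e.left_inv hx])).of_le two_le_infty)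
    (by
      rw [hτx]
      exact (contDiffAt_transition he' he hxt' (by rwa [e'.left_inv hx'])).differentiableAt
        (by simp))
    (hU.mono fun z hz => by simp only [e'.left_inv hz.2, e.right_inv hz.1])
    (by rw [hτx]; exact fderiv_comp_symm_eq_zero he' hu hx' hcrit) (by rwa [hτx])
  have hev : (u ∘ e'.symm) ∘ (fun z => e' (e.symm z)) =ᶠ[𝓝 (e x)] u ∘ e.symm :=
    hU.mono fun z hz => by simp only [Function.comp_apply, e'.left_inv hz.2]
  rwa [hessian_congr hev] at h

namespace BallCover

variable (𝒞 : BallCover n M)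

/-- A bump function which is one near the small coordinate ball. -/
def bump (k : 𝒞.ι) : ContDiffBump (𝒞.center k) :=
  ⟨2 * 𝒞.radius k, 3 * 𝒞.radius k, by linarith [𝒞.radius_pos k], by linarith [𝒞.radius_pos k]⟩

/-- The coordinate functions of the cover, cut off outside of the large balls. -/
noncomputable def coord (j : 𝒞.ι × Fin n) : M → ℝ :=
  extend (𝒞.chart j.1) fun y => 𝒞.bump j.1 y * y j.2

theorem bump_mul_coord_eq_zero (j : 𝒞.ι × Fin n) :
    ∀ y ∉ Metric.closedBall (𝒞.center j.1) (3 * 𝒞.radius j.1), 𝒞.bump j.1 y * y j.2 = 0 := by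
  intro y hy
  rw [(𝒞.bump j.1).zero_of_le_dist (not_le.1 fun h => hy (Metric.mem_closedBall.2 h)).le, zero_mul]

theorem coord_eq_zero (j : 𝒞.ι × Fin n) : ∀ x ∉ 𝒞.bigBall j.1, 𝒞.coord j x = 0 := fun _ hx =>
  extend_eq_zero (𝒞.bump_mul_coord_eq_zero j) hx

theorem contMDiff_coord [IsManifold (𝓡 n) ∞ M] [T2Space M] (j : 𝒞.ι × Fin n) :
    ContMDiff (𝓡 n) 𝓘(ℝ, ℝ) ∞ (𝒞.coord j) :=
  contMDiff_extend (𝒞.chart_mem _) ((𝒞.bump j.1).contDiff.mul (contDiff_coord j.2))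
    (isCompact_closedBall _ _) (𝒞.subset_target _) (𝒞.bump_mul_coord_eq_zero j)

theorem locallyFinite_prod : LocallyFinite fun j : 𝒞.ι × Fin n => 𝒞.bigBall j.1 := fun x => by
  obtain ⟨N, hN, hfin⟩ := 𝒞.locallyFinite x
  exact ⟨N, hN, (hfin.prod (finite_univ (α := Fin n))).subset fun j hj => ⟨hj, trivial⟩⟩

theorem coord_symm (j : 𝒞.ι × Fin n) {y : 𝔼}
    (hy : y ∈ Metric.ball (𝒞.center j.1) (2 * 𝒞.radius j.1)) :
    𝒞.coord j ((𝒞.chart j.1).symm y) = y j.2 := by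
  have hyt : y ∈ (𝒞.chart j.1).target := 𝒞.subset_target _ (Metric.closedBall_subset_closedBall
    (by linarith [𝒞.radius_pos j.1]) (Metric.ball_subset_closedBall hy))
  rw [coord, extend_of_mem _ ((𝒞.chart j.1).map_target hyt), (𝒞.chart j.1).right_inv hyt,
    (𝒞.bump j.1).one_of_mem_closedBall (Metric.ball_subset_closedBall hy), one_mul]

theorem finite_index_bigBall (k : 𝒞.ι) :
    {j : 𝒞.ι × Fin n | (𝒞.bigBall j.1 ∩ 𝒞.bigBall k).Nonempty}.Finite :=
  𝒞.locallyFinite_prod.finite_nonempty_inter_compact (𝒞.isCompact_bigBall k)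

/-- The perturbation of `ψ₀` by the functions `coord`, seen in the coordinates of index `k`. -/
noncomputable def perturbed (ψ₀ : M → ℝ) (t : 𝒞.ι × Fin n → ℝ) (k : 𝒞.ι) : 𝔼 → ℝ := fun y =>
  (ψ₀ ∘ (𝒞.chart k).symm) y
    + ∑ j ∈ (𝒞.finite_index_bigBall k).toFinset, t j * (𝒞.coord j ∘ (𝒞.chart k).symm) y

theorem perturbed_eq (ψ₀ : M → ℝ) (t : 𝒞.ι × Fin n → ℝ) (k : 𝒞.ι) {y : 𝔼}
    (hy : y ∈ Metric.closedBall (𝒞.center k) (3 * 𝒞.radius k)) :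
    ψ₀ ((𝒞.chart k).symm y) + ∑ᶠ j, t j * 𝒞.coord j ((𝒞.chart k).symm y)
      = 𝒞.perturbed ψ₀ t k y := by
  simp only [perturbed, Function.comp_apply]
  congr 1
  refine finsum_eq_sum_of_support_subset _ fun j hj => ?_
  by_contra hjJ
  refine hj ?_
  have : (𝒞.chart k).symm y ∉ 𝒞.bigBall j.1 := fun h =>
    hjJ (by simpa using ⟨_, h, mem_image_of_mem _ hy⟩)
  simp [𝒞.coord_eq_zero j _ this]

theorem contDiffAt_perturbed [IsManifold (𝓡 n) ∞ M] [T2Space M] {ψ₀ : M → ℝ}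
    (hψ₀ : ContMDiff (𝓡 n) 𝓘(ℝ, ℝ) ∞ ψ₀) (t : 𝒞.ι × Fin n → ℝ) {k : 𝒞.ι} {y : 𝔼}
    (hy : y ∈ (𝒞.chart k).target) : ContDiffAt ℝ ∞ (𝒞.perturbed ψ₀ t k) y :=
  (contDiffAt_comp_symm (k := ⊤) (𝒞.chart_mem k) hψ₀ hy).add (ContDiffAt.sum fun j _ =>
    contDiffAt_const.mul (contDiffAt_comp_symm (k := ⊤) (𝒞.chart_mem k) (𝒞.contMDiff_coord j) hy))

/-- On this ball the cut-off of index `k` is 1, so the coefficients of index `k` contribute exactly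
a linear function, to which Sard's theorem applies. -/
theorem perturbed_eq_add (ψ₀ : M → ℝ) {t t' : 𝒞.ι × Fin n → ℝ} (k : 𝒞.ι)
    (ht : ∀ j, j.1 ≠ k → t j = t' j) (ht' : ∀ l, t' (k, l) = 0) {y : 𝔼}
    (hy : y ∈ Metric.ball (𝒞.center k) (2 * 𝒞.radius k)) :
    𝒞.perturbed ψ₀ t k y = 𝒞.perturbed ψ₀ t' k y + ∑ l, t (k, l) * y l := by
  classical
  have hsub : Finset.univ.map ⟨fun l : Fin n => (k, l), Prod.mk_right_injective k⟩
      ⊆ (𝒞.finite_index_bigBall k).toFinset := by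
    intro j hj
    obtain ⟨l, -, rfl⟩ := Finset.mem_map.1 hj
    obtain ⟨x, hx⟩ := 𝒞.nonempty_ball k
    exact (𝒞.finite_index_bigBall k).mem_toFinset.2
      ⟨x, 𝒞.ball_subset_bigBall k hx, 𝒞.ball_subset_bigBall k hx⟩
  simp only [perturbed, add_assoc, add_right_inj]
  rw [← sub_eq_iff_eq_add', ← Finset.sum_sub_distrib, ← Finset.sum_subset hsub]
  · rw [Finset.sum_map]
    refine Finset.sum_congr rfl fun l _ => ?_
    simp [ht', 𝒞.coord_symm (k, l) hy]
  · intro j _ hj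
    have : j.1 ≠ k := fun h => hj (Finset.mem_map.2 ⟨j.2, Finset.mem_univ _, by simp [← h]⟩)
    rw [ht j this, sub_self]

theorem dense_setOf_nondegenerateOn [IsManifold (𝓡 n) ∞ M] [T2Space M] {ψ₀ : M → ℝ}
    (hψ₀ : ContMDiff (𝓡 n) 𝓘(ℝ, ℝ) ∞ ψ₀) (k : 𝒞.ι) :
    Dense {t : 𝒞.ι × Fin n → Icc (-1 : ℝ) 1 | NondegenerateOn
      (𝒞.perturbed ψ₀ (fun j => (t j : ℝ)) k) (Metric.closedBall (𝒞.center k) (𝒞.radius k))} := by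
  classical
  rw [dense_iff_inter_open]
  rintro O hO ⟨t₀, ht₀⟩
  have h11 : (-1 : ℝ) ≤ 1 := by norm_num
  -- Only the coefficients of ball `k` vary. Clamping makes `Φ` continuous on the whole space; it
  -- changes nothing on the cube, and `Φ 0` is the unperturbed base point.
  let Φ : 𝔼 → 𝒞.ι × Fin n → Icc (-1 : ℝ) 1 := fun τ j =>
    if j.1 = k then projIcc (-1) 1 h11 (τ j.2) else t₀ j
  have hΦ : Continuous Φ := by
    refine continuous_pi fun j => ?_
    by_cases hj : j.1 = k
    · simp only [Φ, if_pos hj]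
      exact continuous_projIcc.comp (contDiff_coord j.2).continuous
    · simp only [Φ, if_neg hj]
      exact continuous_const
  let τ₀ : 𝔼 := WithLp.toLp 2 fun l => (t₀ (k, l) : ℝ)
  have hΦ₀ : Φ τ₀ = t₀ := by
    ext ⟨i, l⟩
    by_cases hj : i = k
    · subst hj
      simp [Φ, τ₀]
    · simp [Φ, hj]
  let U := Metric.ball (𝒞.center k) (2 * 𝒞.radius k)
  have hsm : ∀ y ∈ U, ContDiffAt ℝ ∞ (𝒞.perturbed ψ₀ (fun j => (Φ 0 j : ℝ)) k) y := fun y hy =>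
    𝒞.contDiffAt_perturbed hψ₀ _ (𝒞.subset_target _ (Metric.closedBall_subset_closedBall
      (by linarith [𝒞.radius_pos k]) (Metric.ball_subset_closedBall hy)))
  obtain ⟨τ, hτO, hτ, hτ1⟩ := exists_mem_cube_of_ae
    (ae_nondegenerate fun y hy => (hsm y hy).of_le three_le_infty) (hO.preimage hΦ) (τ₀ := τ₀)
    (by rwa [mem_preimage, hΦ₀]) fun l => abs_le.2 (t₀ (k, l)).2
  have hΦτ : ∀ l, (Φ τ (k, l) : ℝ) = τ l := fun l => by
    simp only [Φ, if_true]
    rw [projIcc_of_mem h11 (abs_le.1 (hτ1 l))]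
  refine ⟨Φ τ, hτO, fun y hy => nondegenerateOn_of_linear_perturbation Metric.isOpen_ball hsm hτ
    (fun z hz => ?_) y (Metric.closedBall_subset_ball (by linarith [𝒞.radius_pos k]) hy)⟩
  rw [𝒞.perturbed_eq_add ψ₀ (t := fun j => (Φ τ j : ℝ)) (t' := fun j => (Φ 0 j : ℝ)) k ?_ ?_ hz]
  · simp only [hΦτ]
  · intro j hj
    simp [Φ, hj]
  · intro l
    simp only [Φ, if_true, PiLp.zero_apply]
    rw [projIcc_of_mem h11 (by norm_num : (0 : ℝ) ∈ Icc (-1 : ℝ) 1)]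

/-- A smooth function becomes a Morse function by adding suitable combinations of cut off
coordinate functions with coefficients in `[-1, 1]`. -/
theorem exists_isMorse [IsManifold (𝓡 n) ∞ M] [T2Space M] [SigmaCompactSpace M] {ψ₀ : M → ℝ}
    (hψ₀ : ContMDiff (𝓡 n) 𝓘(ℝ, ℝ) ∞ ψ₀) :
    ∃ t : 𝒞.ι × Fin n → ℝ, (∀ j, |t j| ≤ 1) ∧
      IsMorse n fun x => ψ₀ x + ∑ᶠ j, t j * 𝒞.coord j x := by
  have := 𝒞.countable_index
  have hball : ∀ k, Metric.closedBall (𝒞.center k) (𝒞.radius k)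
      ⊆ Metric.ball (𝒞.center k) (3 * 𝒞.radius k) := fun k =>
    Metric.closedBall_subset_ball (by linarith [𝒞.radius_pos k])
  have hballt : ∀ k, Metric.closedBall (𝒞.center k) (𝒞.radius k) ⊆ (𝒞.chart k).target := fun k =>
    (hball k).trans (Metric.ball_subset_closedBall.trans (𝒞.subset_target k))
  have hopen : ∀ k, IsOpen {t : 𝒞.ι × Fin n → Icc (-1 : ℝ) 1 | NondegenerateOn
      (𝒞.perturbed ψ₀ (fun j => (t j : ℝ)) k)
      (Metric.closedBall (𝒞.center k) (𝒞.radius k))} := fun k =>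
    isOpen_setOf_nondegenerateOn _ (fun j => continuous_subtype_val.comp (continuous_apply j))
      (isCompact_closedBall _ _)
      (fun y hy => contDiffAt_comp_symm (k := ⊤) (𝒞.chart_mem k) hψ₀ (hballt k hy))
      fun j y hy => contDiffAt_comp_symm (k := ⊤) (𝒞.chart_mem k) (𝒞.contMDiff_coord j)
        (hballt k hy)
  have : Nonempty (𝒞.ι × Fin n → Icc (-1 : ℝ) 1) := ⟨fun _ => ⟨0, by norm_num⟩⟩
  -- Baire's theorem in the compact cube of coefficients, for the countably many balls.
  obtain ⟨t, ht⟩ :=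
    (dense_iInter_of_isOpen hopen fun k => 𝒞.dense_setOf_nondegenerateOn hψ₀ k).nonempty
  have hsm : ContMDiff (𝓡 n) 𝓘(ℝ, ℝ) ∞ fun x => ψ₀ x + ∑ᶠ j, (t j : ℝ) * 𝒞.coord j x :=
    hψ₀.add (contMDiff_finsum_mul 𝒞.locallyFinite_prod 𝒞.coord_eq_zero 𝒞.contMDiff_coord _)
  refine ⟨fun j => t j, fun j => abs_le.2 (t j).2, hsm, fun x hcrit e he hx => ?_⟩
  obtain ⟨k, y, hy, rfl⟩ := 𝒞.exists_mem x
  have hyc := Metric.ball_subset_closedBall hy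
  have hyt := hballt k hyc
  have hxk := (𝒞.chart k).map_target hyt
  refine det_hessian_chart_ne_zero he (𝒞.chart_mem k) hsm hx hxk hcrit ?_
  have hev : (fun x => ψ₀ x + ∑ᶠ j, (t j : ℝ) * 𝒞.coord j x) ∘ (𝒞.chart k).symm
      =ᶠ[𝓝 y] 𝒞.perturbed ψ₀ (fun j => (t j : ℝ)) k := by
    filter_upwards [Metric.isOpen_ball.mem_nhds (hball k hyc)] with z hz
    exact 𝒞.perturbed_eq ψ₀ _ k (Metric.ball_subset_closedBall hz)
  have hfd := fderiv_comp_symm_eq_zero (𝒞.chart_mem k) hsm hxk hcrit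
  rw [(𝒞.chart k).right_inv hyt] at hfd ⊢
  rw [hessian_congr hev]
  refine mem_iInter.1 ht k y hyc fun i => ?_
  rw [← (partialDeriv_congr hev i).self_of_nhds, partialDeriv, hfd]
  simp

end BallCover

end Morse

end EllipticOp

/-! ### Assembly -/

theorem corollary2p1 (n : ℕ) {M : Type*} [TopologicalSpace M] [T2Space M]
    [SecondCountableTopology M] [ChartedSpace (EuclideanSpace ℝ (Fin n)) M]
    [IsManifold (𝓡 n) ∞ M] [ConnectedSpace M] [NoncompactSpace M]
    (A : (M → ℝ) → (M → ℝ)) (hA : EllipticOp.IsLocallyUniformlyElliptic n A)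
    (ρ : M → ℝ) (hρ : Continuous ρ) (hρpos : ∀ x, 0 < ρ x) :
    ∃ ψ : M → ℝ, EllipticOp.IsMorse n ψ ∧ (∀ x, ρ x < ψ x) ∧ (∀ x, ρ x < A ψ x) := by
  open EllipticOp in
  have : LocallyCompactSpace M := ChartedSpace.locallyCompactSpace (EuclideanSpace ℝ (Fin n)) M
  obtain ⟨𝒞⟩ := exists_ballCover (n := n) (M := M)
  choose d hd0 hd using fun j => (hA.locallyBoundedOn_apply (𝒞.contMDiff_coord j)).exists_bound
    (𝒞.isCompact_bigBall j.1) (subset_univ _)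
  choose b hb0 hb using fun j => (LocallyBoundedOn.of_continuousAt (s := univ) fun x _ =>
    (𝒞.contMDiff_coord j).continuous.continuousAt).exists_bound
    (𝒞.isCompact_bigBall j.1) (subset_univ _)
  have hχ : ∀ (j : 𝒞.ι × Fin n), ∀ x ∉ 𝒞.bigBall j.1,
      (𝒞.bigBall j.1).indicator (fun _ => b j + d j) x = 0 := fun j x hx =>
    indicator_of_notMem hx _
  -- The sum bounds every perturbation with coefficients in `[-1, 1]` (through `b`) and its image
  -- under `A` (through `d`), so it can be fixed before `t` is known. It need not be continuous,
  -- only locally bounded. The factor 1 fits `eventually_finsum_eq_sum`.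
  let S : M → ℝ := fun x => ρ x + ∑ᶠ j, 1 * (𝒞.bigBall j.1).indicator (fun _ => b j + d j) x
  have hS : LocallyBoundedOn S univ := by
    refine LocallyBoundedOn.add (.of_continuousAt fun x _ => hρ.continuousAt) fun x _ => ?_
    obtain ⟨J, -, hJ⟩ := eventually_finsum_eq_sum 𝒞.locallyFinite_prod x
    refine ⟨∑ j ∈ J, (b j + d j), ?_⟩
    filter_upwards [hJ _ hχ fun _ => 1] with z hz
    rw [hz]
    refine (Finset.abs_sum_le_sum_abs _ _).trans (Finset.sum_le_sum fun j _ => ?_)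
    have : 0 ≤ b j + d j := add_nonneg (hb0 j) (hd0 j)
    rw [one_mul]
    by_cases h : z ∈ 𝒞.bigBall j.1
    · rw [indicator_of_mem h, abs_of_nonneg this]
    · rwa [indicator_of_notMem h, abs_zero]
  obtain ⟨ψ₀, hψ₀, hψS, hAS⟩ := 𝒞.exists_subsolution hA hS
  obtain ⟨t, ht, hmorse⟩ := 𝒞.exists_isMorse hψ₀
  refine ⟨_, hmorse, ?_⟩
  rw [← forall_and]
  intro x
  obtain ⟨J, -, hJ⟩ := eventually_finsum_eq_sum 𝒞.locallyFinite_prod x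
  have hpsm := contMDiff_finsum_mul 𝒞.locallyFinite_prod 𝒞.coord_eq_zero 𝒞.contMDiff_coord t
  have hsum := hJ _ 𝒞.coord_eq_zero t
  have hSx : S x = ρ x + ∑ j ∈ J, 1 * (𝒞.bigBall j.1).indicator (fun _ => b j + d j) x :=
    congrArg (ρ x + ·) (hJ _ hχ fun _ => 1).self_of_nhds
  have hψsm : ContMDiff (𝓡 n) 𝓘(ℝ, ℝ) ∞ fun x => ψ₀ x + ∑ᶠ j, t j * 𝒞.coord j x := hψ₀.add hpsm
  have hAadd : A (fun x => ψ₀ x + ∑ᶠ j, t j * 𝒞.coord j x) x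
      = A ψ₀ x + ∑ j ∈ J, t j * A (𝒞.coord j) x := by
    have h := hA.apply_eq_sum (Finset.insertNone J) (fun o => o.elim 1 t)
      (f := fun o => o.elim ψ₀ 𝒞.coord) (by
        rintro (_ | j) _
        exacts [hψ₀, 𝒞.contMDiff_coord j]) hψsm (x := x) (by
        filter_upwards [hsum] with z hz
        simpa [Finset.sum_insertNone] using hz)
    simpa [Finset.sum_insertNone] using h
  have hbound : ∀ (j : 𝒞.ι × Fin n) (v : ℝ), (x ∈ 𝒞.bigBall j.1 → |v| ≤ b j + d j) →
      (x ∉ 𝒞.bigBall j.1 → v = 0) →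
      -(1 * (𝒞.bigBall j.1).indicator (fun _ => b j + d j) x) ≤ t j * v := fun j v h1 h2 => by
    by_cases hx : x ∈ 𝒞.bigBall j.1
    · rw [indicator_of_mem hx, one_mul]
      refine (abs_le.1 ?_).1
      rw [abs_mul]
      exact (mul_le_of_le_one_left (abs_nonneg v) (ht j)).trans (h1 hx)
    · simp [hx, h2 hx]
  constructor
  · have h1 := Finset.sum_le_sum fun j (_ : j ∈ J) => hbound j (𝒞.coord j x)
      (fun hx => (hb j x hx).trans (le_add_of_nonneg_right (hd0 j))) (𝒞.coord_eq_zero j x)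
    rw [Finset.sum_neg_distrib] at h1
    have h2 := hsum.self_of_nhds
    have h3 := hψS x
    simp only at h2
    linarith
  · have h1 := Finset.sum_le_sum fun j (_ : j ∈ J) => hbound j (A (𝒞.coord j) x)
      (fun hx => (hd j x hx).trans (le_add_of_nonneg_left (hb0 j))) fun hx =>
        hA.apply_eq_zero (𝒞.contMDiff_coord j) (𝒞.isCompact_bigBall j.1).isClosed
          (𝒞.coord_eq_zero j) hx
    rw [Finset.sum_neg_distrib] at h1
    have h3 := hAS x
    linarith
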